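/- Fix a coupling constant $\alpha>0$, an ultraviolet cutoff $\Lambda>0$ and a periodic box of side $L$ and volume $V=L^3$. For the finitely many wave vectors $k\in\frac{2\pi}{L}\mathbb Z^3$ with $0<|k|<\Lambda$ let $\varepsilon_1(k),\varepsilon_2(k)\in\mathbb R^3$ be orthonormal polarization vectors orthogonal to $k$, let $a_\lambda(k),a_\lambda^*(k)$ be the bosonic annihilation and creation operators on the Fock space $\mathcal F$ of these modes, and put $$A(x)=\frac1{\sqrt{2V}}\sum_{0<|k|<\Lambda}\sum_{\lambda=1,2}\frac{\varepsilon_\lambda(k)}{\sqrt{|k|}}\bigl[a_\lambda(k)e^{ik\cdot x}+a_\lambda^*(k)e^{-ik\cdot x}\bigr],\qquad H_f=\sum_{0<|k|<\Lambda}\sum_{\lambda=1,2}|k|\,a_\lambda^*(k)a_\lambda(k).$$ On $L^2(\mathbb R^3)\otimes\mathcal F$ consider the Hamiltonian of one non-relativistic electron, $$H=\tfrac12\bigl(p+\sqrt\alpha\,A(x)\bigr)^2+H_f,\qquad p=-i\nabla,$$ on the dense domain $C_c^\infty(\mathbb R^3)\otimes\mathcal F_{\rm fin}$ (algebraic tensor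 product), where $\mathcal F_{\rm fin}$ is the space of polynomials in the $a^*_\lambda(k)$ applied to the vacuum, and its ground state energy $E_0=\inf_{\Psi\neq0}\langle\Psi,H\Psi\rangle/\langle\Psi,\Psi\rangle$ over this domain (the bottom of the spectrum of the Friedrichs extension of $H$). There are universal constants $C_1,C_2>0$ such that for every $\alpha>0$ and every $L_0>0$ there is $\Lambda_0>0$ such that, for all $\Lambda\ge\Lambda_0$, all $L\ge L_0$ and every choice of polarization vectors, $$C_1\,\alpha^{1/2}\Lambda^{3/2}<E_0<C_2\,\alpha^{2/7}\Lambda^{12/7}.$$ -/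

import Mathlib

noncomputable section

namespace NonRelQED

open MeasureTheory
open scoped ComplexConjugate ContDiff

/-- Physical space `ℝ³` (also the space of wave vectors), with the Euclidean norm. -/
abbrev Space : Type := EuclideanSpace ℝ (Fin 3)

/-! ### Photon modes in a periodic box with an ultraviolet cutoff -/

/-- The wave vector `k = 2 π n / L` of the box of side `L`. -/
def waveVector (L : ℝ) (n : Fin 3 → ℤ) : Space :=
  WithLp.toLp 2 fun i => 2 * Real.pi * (n i : ℝ) / L

theorem finite_cutoff (L Λ : ℝ) (hL : 0 < L) :
    {n : Fin 3 → ℤ | n ≠ 0 ∧ ‖waveVector L n‖ < Λ}.Finite := by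
  refine (Fintype.piFinset fun _ : Fin 3 =>
    Finset.Icc (-⌈Λ * L⌉) ⌈Λ * L⌉).finite_toSet.subset ?_
  rintro n ⟨-, hn⟩
  simp only [Finset.mem_coe, Fintype.mem_piFinset, Finset.mem_Icc, ← abs_le]
  intro i
  have h1 : |2 * Real.pi * (n i : ℝ) / L| < Λ :=
    lt_of_le_of_lt (PiLp.norm_apply_le (waveVector L n) i) hn
  rw [abs_div, abs_of_pos hL, div_lt_iff₀ hL, abs_mul,
    abs_of_pos (by positivity : (0 : ℝ) < 2 * Real.pi)] at h1
  have h2 : |(n i : ℝ)| ≤ 2 * Real.pi * |(n i : ℝ)| :=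
    le_mul_of_one_le_left (abs_nonneg _) (by linarith [Real.pi_gt_three])
  have h3 : ((|n i| : ℤ) : ℝ) ≤ (⌈Λ * L⌉ : ℝ) := by
    push_cast
    linarith [Int.le_ceil (Λ * L)]
  exact_mod_cast h3

/-- The labels `n ∈ ℤ³` of the wave vectors `k` with `0 < |k| < Λ`. -/
def cutoffLabels (L Λ : ℝ) (hL : 0 < L) : Finset (Fin 3 → ℤ) :=
  (finite_cutoff L Λ hL).toFinset

/-- A photon mode `(k, λ)`: a wave vector below the cutoff and one of two polarizations. -/
abbrev Mode (L Λ : ℝ) (hL : 0 < L) : Type := cutoffLabels L Λ hL × Fin 2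

/-- The wave vector of a mode. -/
def Mode.k {L Λ : ℝ} {hL : 0 < L} (m : Mode L Λ hL) : Space := waveVector L m.1.1

/-- `ε k 0`, `ε k 1` are polarization vectors: orthonormal and orthogonal to `k`, for each
nonzero wave vector `k`. -/
def IsPolarization (ε : Space → Fin 2 → Space) : Prop :=
  ∀ k : Space, k ≠ 0 →
    (∀ i j : Fin 2, inner ℝ (ε k i) (ε k j) = if i = j then 1 else 0) ∧
    ∀ i : Fin 2, inner ℝ (ε k i) k = 0

/-! ### Fock space over finitely many modes, in the occupation number basis

The basis vector `|n⟩`, `n : ι → ℕ`, is `∏ i, (a i)^* ^ (n i) / √(n i)!` applied to the vacuum.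
A Fock vector is given by its coefficients. -/

section Fock

variable {ι : Type} [DecidableEq ι]

/-- The annihilation operator of the mode `i`: `a |n⟩ = √(n i) |n - e_i⟩`. -/
def annihilate (i : ι) (v : (ι → ℕ) → ℂ) : (ι → ℕ) → ℂ :=
  fun n => (Real.sqrt ((n i : ℝ) + 1) : ℂ) * v (n + Pi.single i 1)

/-- The creation operator of the mode `i`: `a^* |n⟩ = √(n i + 1) |n + e_i⟩`. The coefficient
vanishes when `n i = 0`, so the truncated subtraction plays no role. -/
def create (i : ι) (v : (ι → ℕ) → ℂ) : (ι → ℕ) → ℂ :=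
  fun n => (Real.sqrt (n i : ℝ) : ℂ) * v (n - Pi.single i 1)

end Fock

/-! ### Electron and photons -/

/-- Wave functions of the electron and the photons: `Ψ x n` is the amplitude of the electron at
`x` and occupation numbers `n`. -/
abbrev Wave (L Λ : ℝ) (hL : 0 < L) : Type := Space → (Mode L Λ hL → ℕ) → ℂ

section Operators

variable {L Λ : ℝ} {hL : 0 < L}

/-- The inner product of `L²(ℝ³) ⊗ ℱ`. -/
def innerProduct (Φ Ψ : Wave L Λ hL) : ℂ :=
  ∫ x : Space, ∑' n : Mode L Λ hL → ℕ, conj (Φ x n) * Ψ x n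

/-- The dense domain `C_c^∞(ℝ³) ⊗ ℱ_fin` (algebraic tensor product), `ℱ_fin` being the space of
polynomials in the creation operators applied to the vacuum. -/
structure IsCore (Ψ : Wave L Λ hL) : Prop where
  smooth : ∀ n, ContDiff ℝ ∞ fun x => Ψ x n
  compact : ∀ n, HasCompactSupport fun x => Ψ x n
  finite : {n | ∃ x, Ψ x n ≠ 0}.Finite

/-- The `j`-th component of the electron momentum `p = -i ∇`. -/
def momentum (j : Fin 3) (Ψ : Wave L Λ hL) : Wave L Λ hL :=
  fun x n => -Complex.I * fderiv ℝ (fun y => Ψ y n) x (EuclideanSpace.single j 1)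

/-- The `j`-th component of the quantized vector potential `A(x)`, where `V = L ^ 3`. -/
def vectorPotential (ε : Space → Fin 2 → Space) (j : Fin 3) (Ψ : Wave L Λ hL) : Wave L Λ hL :=
  fun x n => ((1 / Real.sqrt (2 * L ^ 3) : ℝ) : ℂ) *
    ∑ m : Mode L Λ hL, ((1 / Real.sqrt ‖m.k‖ * ε m.k m.2 j : ℝ) : ℂ) *
      (Complex.exp (Complex.I * (inner ℝ m.k x : ℝ)) * annihilate m (Ψ x) n +
        Complex.exp (-Complex.I * (inner ℝ m.k x : ℝ)) * create m (Ψ x) n)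

/-- The field energy `H_f = ∑ |k| a^* a`. -/
def fieldEnergy (Ψ : Wave L Λ hL) : Wave L Λ hL :=
  fun x n => ∑ m : Mode L Λ hL, (‖m.k‖ : ℂ) * create m (annihilate m (Ψ x)) n

/-- The `j`-th component of `p + √α A(x)`. -/
def kineticMomentum (α : ℝ) (ε : Space → Fin 2 → Space) (j : Fin 3) (Ψ : Wave L Λ hL) :
    Wave L Λ hL :=
  fun x n => momentum j Ψ x n + (Real.sqrt α : ℂ) * vectorPotential ε j Ψ x n

/-- The Hamiltonian `H = ½ (p + √α A(x))² + H_f`. -/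
def hamiltonian (α : ℝ) (ε : Space → Fin 2 → Space) (Ψ : Wave L Λ hL) : Wave L Λ hL :=
  fun x n => (1 / 2 : ℂ) * ∑ j : Fin 3, kineticMomentum α ε j (kineticMomentum α ε j Ψ) x n +
    fieldEnergy Ψ x n

end Operators

/-- The ground state energy `E₀ = inf ⟨Ψ, H Ψ⟩ / ⟨Ψ, Ψ⟩` over the nonzero `Ψ` of the dense domain
on which `H` is given, that is, the bottom of the spectrum of (the Friedrichs extension of) `H`. -/
def groundStateEnergy (α Λ L : ℝ) (hL : 0 < L) (ε : Space → Fin 2 → Space) : ℝ :=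
  sInf {e : ℝ | ∃ Ψ : Wave L Λ hL, IsCore Ψ ∧ Ψ ≠ 0 ∧
    e = (innerProduct Ψ (hamiltonian α ε Ψ)).re / (innerProduct Ψ Ψ).re}

end NonRelQED

end

noncomputable section

namespace NonRelQED

open MeasureTheory
open scoped ComplexConjugate ContDiff

set_option linter.unusedSectionVars false

/-! ### Canonical commutation relations on an inner product space -/

section CCR

variable {E : Type*} [NormedAddCommGroup E] [InnerProductSpace ℂ E]
  {ι : Type*} [Fintype ι] [DecidableEq ι]

/-! Both bounds rest on the canonical commutation relations; they are set up for an abstract inner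
product space and used twice, on Fock space and on the full core.

Lower bound. Write `v = p + √α A`. The vectors `e^{ikx} a` and `e^{-ikx} a*` again satisfy the CCR,
and `A` is a combination of them with constant coefficients. Take the antisymmetric field `Y = ∑ d ε
(e^{ikx} a - e^{-ikx} a*)`. Since `ε ⟂ k`, the commutators `[p_j, Y_j]` sum to zero, while `[A_j,
Y_j]` is a number, so `∑ ‖(v_j + Y_j) Ψ‖² ≥ 0` bounds the kinetic energy below by a number minus `∑
‖Y_j Ψ‖²` (`kinetic_lower_bound`). With `d` proportional to `√|k|`, the part of `Y²` that is not a
number is absorbed exactly by `H_f`, and what remains is of order `√α √(M / L³) - Λ` for `M` modes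
(`energy_lower_bound`). Counting lattice points gives `M ≳ (LΛ)³` (`card_mode_ge`).

Upper bound. Put `Λ = α r⁷` and use a product `φ ⊗ Θ`, with `φ` supported in a ball of radius `1/K`,
`K = α r⁶`. On that ball `|k_i x_i| ≤ r`, so Taylor polynomials with `n ~ 8r` terms per coordinate
place the one-particle vectors of `A_j(x)` close to a space of dimension at most `3n³`
(`norm_prod_exp_sub_le`). The symmetry `k ↦ -k` makes all relevant inner products real, so an
orthonormal basis of this space can be squeezed mode by mode along the field quadratures in `A`
(`exists_orthonormal_of_real`, `exists_squeezed`). Allowing fewer than `2N` photons per mode reduces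
`⟨A²⟩ ≲ Λ²` by the factor `6/N`. The cost is of order `K² + αΛ²/N + Λ N n³`; with `N ~ α r²` every
term is of order `α² r¹² = α^{2/7} Λ^{12/7}`. -/

/-- `a i` and `ad i` are annihilation and creation operators. -/
structure IsCCR (a ad : ι → E →ₗ[ℂ] E) : Prop where
  adj : ∀ i x y, inner ℂ (ad i x) y = inner ℂ x (a i y)
  comm : ∀ i j x, a i (ad j x) = ad j (a i x) + if i = j then x else 0
  comm_ann : ∀ i j x, a i (a j x) = a j (a i x)

/-- The annihilation operator of a one-particle vector. -/
def ann (a : ι → E →ₗ[ℂ] E) (f : EuclideanSpace ℂ ι) : E →ₗ[ℂ] E := ∑ i, conj (f i) • a i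

/-- The creation operator of a one-particle vector. -/
def cre (ad : ι → E →ₗ[ℂ] E) (f : EuclideanSpace ℂ ι) : E →ₗ[ℂ] E := ∑ i, f i • ad i

theorem ann_apply (a : ι → E →ₗ[ℂ] E) (f : EuclideanSpace ℂ ι) (x : E) :
    ann a f x = ∑ i, conj (f i) • a i x := by simp [ann]

theorem cre_apply (ad : ι → E →ₗ[ℂ] E) (f : EuclideanSpace ℂ ι) (x : E) :
    cre ad f x = ∑ i, f i • ad i x := by simp [cre]

theorem ann_add (a : ι → E →ₗ[ℂ] E) (f g : EuclideanSpace ℂ ι) :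
    ann a (f + g) = ann a f + ann a g := by
  simp [ann, add_smul, Finset.sum_add_distrib]

theorem cre_add (a : ι → E →ₗ[ℂ] E) (f g : EuclideanSpace ℂ ι) :
    cre a (f + g) = cre a f + cre a g := by
  simp [cre, add_smul, Finset.sum_add_distrib]

theorem ann_smul (a : ι → E →ₗ[ℂ] E) (c : ℂ) (f : EuclideanSpace ℂ ι) :
    ann a (c • f) = conj c • ann a f := by
  simp [ann, Finset.smul_sum, mul_smul]

theorem cre_smul (a : ι → E →ₗ[ℂ] E) (c : ℂ) (f : EuclideanSpace ℂ ι) :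
    cre a (c • f) = c • cre a f := by
  simp [cre, Finset.smul_sum, mul_smul]

namespace IsCCR

variable {a ad : ι → E →ₗ[ℂ] E} (h : IsCCR a ad)
include h

theorem adj' (i : ι) (x y : E) : inner ℂ (a i x) y = inner ℂ x (ad i y) := by
  rw [← inner_conj_symm, ← h.adj, inner_conj_symm]

theorem inner_cre (f : EuclideanSpace ℂ ι) (x y : E) :
    inner ℂ (cre ad f x) y = inner ℂ x (ann a f y) := by
  simp only [cre_apply, ann_apply, sum_inner, inner_sum, inner_smul_left, inner_smul_right, h.adj]

theorem inner_ann (f : EuclideanSpace ℂ ι) (x y : E) :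
    inner ℂ (ann a f x) y = inner ℂ x (cre ad f y) := by
  rw [← inner_conj_symm, ← h.inner_cre, inner_conj_symm]

theorem ann_cre (f g : EuclideanSpace ℂ ι) (x : E) :
    ann a f (cre ad g x) = cre ad g (ann a f x) + inner ℂ f g • x := by
  simp only [ann_apply, cre_apply, map_sum, map_smul, h.comm, smul_add, Finset.sum_add_distrib,
    Finset.smul_sum]
  rw [Finset.sum_comm]
  congr 1
  · refine Finset.sum_congr rfl fun i _ => Finset.sum_congr rfl fun j _ => smul_comm _ _ _
  · rw [PiLp.inner_apply, Finset.sum_smul, Finset.sum_comm]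
    refine Finset.sum_congr rfl fun i _ => ?_
    simp only [smul_ite, smul_zero]
    simp [smul_smul]

theorem ann_ann (f g : EuclideanSpace ℂ ι) (x : E) :
    ann a f (ann a g x) = ann a g (ann a f x) := by
  simp only [ann_apply, map_sum, map_smul, Finset.smul_sum]
  rw [Finset.sum_comm]
  refine Finset.sum_congr rfl fun i _ => Finset.sum_congr rfl fun j _ => ?_
  rw [smul_comm, h.comm_ann]

/-- `IsCCR` only postulates that annihilators commute; for creators this follows by pairing with an
arbitrary vector and taking adjoints. -/
theorem cre_cre (f g : EuclideanSpace ℂ ι) (x : E) :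
    cre ad f (cre ad g x) = cre ad g (cre ad f x) := by
  refine ext_inner_right ℂ fun y => ?_
  rw [h.inner_cre, h.inner_cre, h.inner_cre, h.inner_cre, h.ann_ann]

theorem norm_cre_sq (f : EuclideanSpace ℂ ι) (x : E) :
    ‖cre ad f x‖ ^ 2 = ‖ann a f x‖ ^ 2 + ‖f‖ ^ 2 * ‖x‖ ^ 2 := by
  have h1 : (inner ℂ (cre ad f x) (cre ad f x) : ℂ) =
      inner ℂ (ann a f x) (ann a f x) + inner ℂ f f * inner ℂ x x := by
    rw [h.inner_cre, h.ann_cre, inner_add_right, inner_smul_right, h.inner_ann]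
  simp only [inner_self_eq_norm_sq_to_K] at h1
  exact_mod_cast h1

theorem norm_ann_sq_le (f : EuclideanSpace ℂ ι) (w : ι → ℝ) (hw : ∀ i, 0 < w i) (x : E) :
    ‖ann a f x‖ ^ 2 ≤ (∑ i, ‖f i‖ ^ 2 / w i) * ∑ i, w i * ‖a i x‖ ^ 2 := by
  have h1 : ‖ann a f x‖ ≤ ∑ i, ‖f i‖ * ‖a i x‖ := by
    rw [ann_apply]
    refine (norm_sum_le _ _).trans (Finset.sum_le_sum fun i _ => ?_)
    simp [norm_smul]
  refine (pow_le_pow_left₀ (norm_nonneg _) h1 2).trans ?_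
  refine Finset.sum_sq_le_sum_mul_sum_of_sq_le_mul _ (fun i _ => by have := hw i; positivity)
    (fun i _ => by have := hw i; positivity) fun i _ => ?_
  have := (hw i).ne'
  exact le_of_eq (by field_simp)

end IsCCR

/-- Positivity of `∑ⱼ ‖(vⱼ + Yⱼ) x‖²`, where `v = p + s A` and `Y` is an antisymmetric field
operator whose divergence vanishes and whose commutator with `A` is a number. -/
theorem kinetic_lower_bound {b bd : ι → E →ₗ[ℂ] E} (h : IsCCR b bd)
    (p : Fin 3 → E →ₗ[ℂ] E) (hp : ∀ j x y, inner ℂ (p j x) y = inner ℂ x (p j y))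
    (k e : ι → Fin 3 → ℝ) (c d w : ι → ℝ) (s : ℝ) (hw : ∀ i, 0 < w i)
    (hpb : ∀ j i x, p j (b i x) = b i (p j x) + (k i j : ℂ) • b i x)
    (hpbd : ∀ j i x, p j (bd i x) = bd i (p j x) - (k i j : ℂ) • bd i x)
    (horth : ∀ i, ∑ j, e i j * k i j = 0) (he : ∀ i, ∑ j, e i j ^ 2 = 1) (x : E) :
    2 * s * (∑ i, c i * d i) * ‖x‖ ^ 2 ≤
      ∑ j, ‖p j x + (s : ℂ) • ∑ i, ((c i * e i j : ℝ) : ℂ) • (b i x + bd i x)‖ ^ 2 +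
      4 * (∑ i, d i ^ 2 / w i) * ∑ i, w i * ‖b i x‖ ^ 2 + 2 * (∑ i, d i ^ 2) * ‖x‖ ^ 2 := by
  let F : Fin 3 → EuclideanSpace ℂ ι := fun j => WithLp.toLp 2 fun i => ((d i * e i j : ℝ) : ℂ)
  let G : Fin 3 → EuclideanSpace ℂ ι := fun j => WithLp.toLp 2 fun i => ((c i * e i j : ℝ) : ℂ)
  have hF : ∀ j i, F j i = ((d i * e i j : ℝ) : ℂ) := fun j i => rfl
  have hG : ∀ j i, G j i = ((c i * e i j : ℝ) : ℂ) := fun j i => rfl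
  let A : Fin 3 → E →ₗ[ℂ] E := fun j => ann b (G j) + cre bd (G j)
  let Y : Fin 3 → E →ₗ[ℂ] E := fun j => ann b (F j) - cre bd (F j)
  have hA : ∀ j, ∑ i, ((c i * e i j : ℝ) : ℂ) • (b i x + bd i x) = A j x := by
    intro j
    simp only [A, LinearMap.add_apply, ann_apply, cre_apply, hG, Complex.conj_ofReal, smul_add,
      Finset.sum_add_distrib]
  have hAsymm : ∀ j y z, inner ℂ (A j y) z = inner ℂ y (A j z) := by
    intro j y z
    simp only [A, LinearMap.add_apply, inner_add_left, inner_add_right, h.inner_ann, h.inner_cre]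
    ring
  have hYanti : ∀ j y z, inner ℂ (Y j y) z = - inner ℂ y (Y j z) := by
    intro j y z
    simp only [Y, LinearMap.sub_apply, inner_sub_left, inner_sub_right, h.inner_ann, h.inner_cre]
    ring
  have hFG : ∀ j, (inner ℂ (G j) (F j) : ℂ) = ((∑ i, c i * d i * e i j ^ 2 : ℝ) : ℂ) := by
    intro j
    rw [PiLp.inner_apply]
    push_cast
    refine Finset.sum_congr rfl fun i _ => ?_
    simp [hF, hG]; ring
  have hGF : ∀ j, (inner ℂ (F j) (G j) : ℂ) = ((∑ i, c i * d i * e i j ^ 2 : ℝ) : ℂ) := by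
    intro j
    rw [← inner_conj_symm, hFG, Complex.conj_ofReal]
  have hAY : ∀ j, A j (Y j x) - Y j (A j x) =
      ((-2 * ∑ i, c i * d i * e i j ^ 2 : ℝ) : ℂ) • x := by
    intro j
    simp only [A, Y, LinearMap.add_apply, LinearMap.sub_apply, map_add, map_sub, h.ann_cre,
      h.ann_ann (G j) (F j), h.cre_cre (G j) (F j), hFG, hGF]
    push_cast
    module
  have hpY : ∀ j, p j (Y j x) - Y j (p j x) =
      ∑ i, ((d i * (e i j * k i j) : ℝ) : ℂ) • (b i x + bd i x) := by
    intro j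
    simp only [Y, LinearMap.sub_apply, ann_apply, cre_apply, hF, Complex.conj_ofReal, map_sub,
      map_sum, map_smul, hpb, hpbd, ← Finset.sum_sub_distrib]
    refine Finset.sum_congr rfl fun i _ => ?_
    push_cast
    module
  -- The divergence of `Y` vanishes by transversality: each mode contributes a multiple of `∑ⱼ eⱼ
  -- kⱼ`.
  have hsum : ∑ j, (p j (Y j x) - Y j (p j x)) = 0 := by
    simp only [hpY]
    rw [Finset.sum_comm]
    refine Finset.sum_eq_zero fun i _ => ?_
    rw [← Finset.sum_smul, ← Complex.ofReal_sum, ← Finset.mul_sum, horth]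
    simp
  have hD : ∑ j, ∑ i, c i * d i * e i j ^ 2 = ∑ i, c i * d i := by
    rw [Finset.sum_comm]
    exact Finset.sum_congr rfl fun i _ => by rw [← Finset.mul_sum, he, mul_one]
  -- `p + sA` is symmetric and `Y` antisymmetric, so twice the real part is the expectation of the
  -- commutator `[p + sA, Y]`, of which only the number `s[A, Y]` survives the sum over `j`.
  have hcross : ∑ j, 2 * (inner ℂ (p j x + (s : ℂ) • A j x) (Y j x) : ℂ).re =
      -2 * s * (∑ i, c i * d i) * ‖x‖ ^ 2 := by
    have h1 : ∀ j, ((2 * (inner ℂ (p j x + (s : ℂ) • A j x) (Y j x) : ℂ).re : ℝ) : ℂ) =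
        inner ℂ x ((p j (Y j x) - Y j (p j x)) + (s : ℂ) • (A j (Y j x) - Y j (A j x))) := by
      intro j
      have h2 := Complex.add_conj (inner ℂ (p j x + (s : ℂ) • A j x) (Y j x) : ℂ)
      rw [← h2, inner_conj_symm, hYanti]
      simp only [inner_add_left, inner_smul_left, hp, hAsymm, Complex.conj_ofReal, map_add,
        map_smul, inner_add_right, inner_smul_right, smul_sub, inner_sub_right]
      ring
    apply Complex.ofReal_injective
    rw [Complex.ofReal_sum, Finset.sum_congr rfl fun j _ => h1 j, ← inner_sum,
      Finset.sum_add_distrib, hsum, zero_add]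
    simp only [hAY, ← Finset.smul_sum, ← Finset.sum_smul, ← Complex.ofReal_sum, ← Finset.mul_sum,
      hD, inner_smul_right, inner_self_eq_norm_sq_to_K]
    push_cast
    simp only [Complex.coe_algebraMap]
    ring
  -- The parallelogram law costs a factor 2. The creation part exceeds the annihilation part by
  -- `‖F‖²‖x‖²`, and weighted Cauchy–Schwarz bounds the latter by the field energy.
  have hY : ∀ j, ‖Y j x‖ ^ 2 ≤ 4 * ((∑ i, d i ^ 2 * e i j ^ 2 / w i) * ∑ i, w i * ‖b i x‖ ^ 2) +
      2 * (∑ i, d i ^ 2 * e i j ^ 2) * ‖x‖ ^ 2 := by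
    intro j
    have h1 : ‖Y j x‖ ^ 2 ≤ 2 * ‖ann b (F j) x‖ ^ 2 + 2 * ‖cre bd (F j) x‖ ^ 2 := by
      have := parallelogram_law_with_norm ℂ (ann b (F j) x) (cre bd (F j) x)
      have h2 : ‖Y j x‖ = ‖ann b (F j) x - cre bd (F j) x‖ := rfl
      rw [h2]
      nlinarith [mul_self_nonneg ‖ann b (F j) x + cre bd (F j) x‖]
    have h3 := h.norm_ann_sq_le (F j) w hw x
    have h4 : ∀ i, ‖F j i‖ ^ 2 = d i ^ 2 * e i j ^ 2 := by
      intro i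
      rw [hF, Complex.norm_real, Real.norm_eq_abs, sq_abs, mul_pow]
    have h5 : ‖F j‖ ^ 2 = ∑ i, d i ^ 2 * e i j ^ 2 := by
      rw [EuclideanSpace.norm_sq_eq]
      exact Finset.sum_congr rfl fun i _ => h4 i
    simp only [h4] at h3
    rw [h.norm_cre_sq, h5] at h1
    linarith
  have hYsum := Finset.sum_le_sum fun j (_ : j ∈ Finset.univ) => hY j
  have he1 : ∑ j, ∑ i, d i ^ 2 * e i j ^ 2 / w i = ∑ i, d i ^ 2 / w i := by
    rw [Finset.sum_comm]
    exact Finset.sum_congr rfl fun i _ => by rw [← Finset.sum_div, ← Finset.mul_sum, he, mul_one]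
  have he2 : ∑ j, ∑ i, d i ^ 2 * e i j ^ 2 = ∑ i, d i ^ 2 := by
    rw [Finset.sum_comm]
    exact Finset.sum_congr rfl fun i _ => by rw [← Finset.mul_sum, he, mul_one]
  rw [Finset.sum_add_distrib, ← Finset.mul_sum, ← Finset.sum_mul, ← Finset.sum_mul,
    ← Finset.mul_sum, he1, he2] at hYsum
  simp only [hA]
  have hpos : 0 ≤ ∑ j, ‖(p j x + (s : ℂ) • A j x) + Y j x‖ ^ 2 := by positivity
  have hexp : ∀ j, ‖(p j x + (s : ℂ) • A j x) + Y j x‖ ^ 2 = ‖p j x + (s : ℂ) • A j x‖ ^ 2 +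
      2 * (inner ℂ (p j x + (s : ℂ) • A j x) (Y j x) : ℂ).re + ‖Y j x‖ ^ 2 :=
    fun j => @norm_add_sq ℂ _ _ _ _ _ _
  simp only [hexp] at hpos
  rw [Finset.sum_add_distrib, Finset.sum_add_distrib, hcross] at hpos
  linarith

end CCR

/-! ### Squeezing one mode with finitely many photons -/

/-- The weights `(2m)! / (4 ^ m m! ^ 2)`. -/
def binomWeight (m : ℕ) : ℝ := (m.centralBinom : ℝ) / 4 ^ m

theorem binomWeight_pos (m : ℕ) : 0 < binomWeight m := by
  have : (0 : ℝ) < m.centralBinom := by exact_mod_cast m.centralBinom_pos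
  unfold binomWeight; positivity

theorem binomWeight_antitone : Antitone binomWeight := by
  refine antitone_nat_of_succ_le fun m => ?_
  have h : ((m + 1 : ℕ) : ℝ) * (m + 1).centralBinom = 2 * (2 * m + 1) * m.centralBinom := by
    exact_mod_cast m.succ_mul_centralBinom_succ
  have hm : (0 : ℝ) < m.centralBinom := by exact_mod_cast m.centralBinom_pos
  unfold binomWeight
  rw [div_le_div_iff₀ (by positivity) (by positivity), pow_succ]
  push_cast at h
  have h1 : ((m + 1).centralBinom : ℝ) ≤ 4 * m.centralBinom := by
    have : ((m : ℝ) + 1) * (m + 1).centralBinom ≤ (m + 1) * (4 * m.centralBinom) := by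
      rw [h]; nlinarith
    exact le_of_mul_le_mul_left this (by positivity)
  nlinarith [pow_pos (show (0 : ℝ) < 4 by norm_num) m]

theorem factorial_two_mul_eq (m : ℕ) :
    ((2 * m).factorial : ℝ) = binomWeight m * (2 ^ m * m.factorial) ^ 2 := by
  have h : ((2 * m).factorial : ℝ) = m.centralBinom * m.factorial * m.factorial := by
    have := Nat.choose_mul_factorial_mul_factorial (show m ≤ 2 * m by omega)
    rw [show 2 * m - m = m by omega] at this
    exact_mod_cast this.symm
  rw [h, binomWeight, mul_pow, ← pow_mul, mul_comm m 2, pow_mul]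
  norm_num
  field_simp

theorem sum_sq_le (N : ℕ) :
    (N : ℝ) ^ 3 ≤ 3 * ∑ m ∈ Finset.range N, ((N : ℝ) - m) ^ 2 := by
  have h : ∑ m ∈ Finset.range N, ((N : ℝ) - m) ^ 2 = (N * (N + 1) * (2 * N + 1) : ℝ) / 6 := by
    induction N with
    | zero => simp
    | succ n ih =>
      rw [Finset.sum_range_succ']
      push_cast
      have : ∑ m ∈ Finset.range n, ((n : ℝ) + 1 - (m + 1)) ^ 2 =
          ∑ m ∈ Finset.range n, ((n : ℝ) - m) ^ 2 :=
        Finset.sum_congr rfl fun m _ => by ring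
      rw [this, ih]
      ring
  rw [h]
  have : (0 : ℝ) ≤ N := N.cast_nonneg
  nlinarith [sq_nonneg (N : ℝ)]

/-- Bound `2m + 1` by `2N`. Both `(N - m)²` and the weights decrease in `m`, so Chebyshev's sum
inequality together with `∑ (N - m)² ≥ N³/3` gives `∑ w ≤ (3/N²) ∑ (N - m)² w`. -/
theorem sum_odd_weight_le (N : ℕ) (hN : 0 < N) :
    ∑ m ∈ Finset.range N, (2 * (m : ℝ) + 1) * binomWeight m ≤
      6 / N * ∑ m ∈ Finset.range N, ((N : ℝ) - m) ^ 2 * binomWeight m := by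
  have hN' : (0 : ℝ) < N := by exact_mod_cast hN
  have h1 : ∑ m ∈ Finset.range N, (2 * (m : ℝ) + 1) * binomWeight m ≤
      2 * N * ∑ m ∈ Finset.range N, binomWeight m := by
    rw [Finset.mul_sum]
    refine Finset.sum_le_sum fun m hm => ?_
    have : (m : ℝ) + 1 ≤ N := by exact_mod_cast Finset.mem_range.1 hm
    exact mul_le_mul_of_nonneg_right (by linarith) (binomWeight_pos m).le
  have h2 : MonovaryOn (fun m : ℕ => ((N : ℝ) - m) ^ 2) binomWeight (Finset.range N) := by
    intro i hi j hj hij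
    have hji : j < i := by
      by_contra hh
      exact absurd (binomWeight_antitone (not_lt.1 hh)) (not_le.2 hij)
    have hi' : (i : ℝ) ≤ N := by
      exact_mod_cast (Finset.mem_range.1 (Finset.mem_coe.1 hi)).le
    have : (j : ℝ) ≤ i := by exact_mod_cast hji.le
    exact pow_le_pow_left₀ (by linarith) (by linarith) 2
  have h3 := h2.sum_mul_sum_le_card_mul_sum
  rw [Finset.card_range] at h3
  have h4 := mul_le_mul_of_nonneg_right (sum_sq_le N)
    (Finset.sum_nonneg fun m (_ : m ∈ Finset.range N) => (binomWeight_pos m).le)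
  rw [div_mul_eq_mul_div, le_div_iff₀ hN']
  have h5 : (N : ℝ) * (∑ m ∈ Finset.range N, (2 * (m : ℝ) + 1) * binomWeight m) * N ≤
      N * (6 * ∑ m ∈ Finset.range N, ((N : ℝ) - m) ^ 2 * binomWeight m) := by
    have h6 := mul_le_mul_of_nonneg_left h1 (show (0 : ℝ) ≤ N * N by positivity)
    nlinarith
  exact le_of_mul_le_mul_left (by nlinarith) hN'

section SingleMode

variable {E : Type*} [NormedAddCommGroup E] [InnerProductSpace ℂ E]

/-- A truncation of `exp (-c ^ 2 / 2)`. -/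
def squeeze (N : ℕ) (c : Module.End ℂ E) : Module.End ℂ E :=
  ∑ m ∈ Finset.range N, (((-1) ^ m * ((N : ℝ) - m) / (2 ^ m * m.factorial) : ℝ) : ℂ) • c ^ (2 * m)

theorem squeeze_apply (N : ℕ) (c : Module.End ℂ E) (x : E) :
    squeeze N c x = ∑ m ∈ Finset.range N,
      (((-1) ^ m * ((N : ℝ) - m) / (2 ^ m * m.factorial) : ℝ) : ℂ) • (c ^ (2 * m)) x := by
  simp [squeeze]

theorem squeeze_comm (N : ℕ) (c T : Module.End ℂ E) (h : ∀ x, T (c x) = c (T x)) (x : E) :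
    T (squeeze N c x) = squeeze N c (T x) := by
  have h1 : Commute T c := LinearMap.ext h
  simp only [squeeze_apply, map_sum, map_smul]
  refine Finset.sum_congr rfl fun m _ => ?_
  congr 1
  exact LinearMap.congr_fun (h1.pow_right (2 * m)).eq x

/-- The squared norm of `squeeze` on vectors annihilated by `b`. -/
def squeezeNorm (N : ℕ) : ℝ := ∑ m ∈ Finset.range N, ((N : ℝ) - m) ^ 2 * binomWeight m

theorem squeezeNorm_pos {N : ℕ} (hN : 0 < N) : 0 < squeezeNorm N := by
  refine Finset.sum_pos (fun m hm => ?_) ⟨0, Finset.mem_range.2 hN⟩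
  have : (m : ℝ) < N := by exact_mod_cast Finset.mem_range.1 hm
  have h := binomWeight_pos m
  have : 0 < (N : ℝ) - m := by linarith
  positivity

variable {b c : Module.End ℂ E} (hadj : ∀ x y, inner ℂ (c x) y = inner ℂ x (b y))
  (hcomm : ∀ x, b (c x) = c (b x) + x)
include hcomm

theorem lower_pow_succ {x : E} (hx : b x = 0) (n : ℕ) :
    b ((c ^ (n + 1)) x) = ((n : ℂ) + 1) • (c ^ n) x := by
  induction n with
  | zero => simp [hcomm, hx]
  | succ n ih =>
    rw [pow_succ', Module.End.mul_apply, hcomm, ih, map_smul, ← Module.End.mul_apply, ← pow_succ']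
    push_cast
    module

include hadj

theorem inner_pow_pow {x y : E} (hx : b x = 0) (hy : b y = 0) (m n : ℕ) :
    inner ℂ ((c ^ m) x) ((c ^ n) y) = if m = n then (m.factorial : ℂ) * inner ℂ x y else 0 := by
  induction m generalizing n with
  | zero =>
    cases n with
    | zero => simp
    | succ n =>
      rw [← inner_conj_symm, pow_succ', Module.End.mul_apply, hadj]
      simp [hx]
  | succ m ih =>
    rw [pow_succ', Module.End.mul_apply, hadj]
    cases n with
    | zero => simp [hy]
    | succ n =>
      rw [lower_pow_succ hcomm hy, inner_smul_right, ih]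
      by_cases h : m = n
      · subst h
        simp only [if_true, Nat.factorial_succ]
        push_cast
        ring
      · simp [h]

theorem norm_sq_sum_pow {x : E} (hx : b x = 0) (s : Finset ℕ) (u : ℕ → ℕ)
    (hu : Function.Injective u) (y : ℕ → ℝ) :
    ‖∑ m ∈ s, (y m : ℂ) • (c ^ u m) x‖ ^ 2 = (∑ m ∈ s, y m ^ 2 * (u m).factorial) * ‖x‖ ^ 2 := by
  have h : (inner ℂ (∑ m ∈ s, (y m : ℂ) • (c ^ u m) x) (∑ m ∈ s, (y m : ℂ) • (c ^ u m) x) : ℂ) =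
      ∑ m ∈ s, (y m : ℂ) ^ 2 * (u m).factorial * inner ℂ x x := by
    rw [sum_inner]
    refine Finset.sum_congr rfl fun m hm => ?_
    rw [inner_sum, Finset.sum_eq_single m]
    · rw [inner_smul_left, inner_smul_right, inner_pow_pow hadj hcomm hx hx, if_pos rfl,
        Complex.conj_ofReal]
      ring
    · intro k _ hk
      rw [inner_smul_left, inner_smul_right, inner_pow_pow hadj hcomm hx hx,
        if_neg fun hh => hk (hu hh).symm]
      simp
    · exact fun hh => absurd hm hh
  rw [← Finset.sum_mul] at h
  generalize ∑ m ∈ s, (y m : ℂ) • (c ^ u m) x = v at h ⊢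
  simp only [inner_self_eq_norm_sq_to_K] at h
  apply Complex.ofReal_injective
  push_cast
  exact h

theorem norm_squeeze_sq (N : ℕ) {x : E} (hx : b x = 0) :
    ‖squeeze N c x‖ ^ 2 = squeezeNorm N * ‖x‖ ^ 2 := by
  rw [squeeze_apply, norm_sq_sum_pow hadj hcomm hx _ (fun m => 2 * m)
    (fun m n h => by simpa using h), squeezeNorm]
  congr 1
  refine Finset.sum_congr rfl fun m _ => ?_
  rw [factorial_two_mul_eq, div_pow, mul_pow, ← pow_mul, mul_comm m 2, pow_mul]
  have : (0 : ℝ) < m.factorial := by exact_mod_cast m.factorial_pos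
  field_simp
  norm_num

/-- Formally `b + c` kills `exp(-c²/2) x`, because `b` acts as differentiation in `c`. The linear
cutoff `N - m` spoils the cancellation only by `(N - m) - (N - m - 1) = 1`, so the residue has
coefficients of size 1 against `N - m` in the vector itself. This is the source of the gain `1/N`.
-/
theorem field_squeeze (N : ℕ) {x : E} (hx : b x = 0) :
    b (squeeze N c x) + c (squeeze N c x) = ∑ m ∈ Finset.range N,
      (((-1) ^ m / (2 ^ m * m.factorial) : ℝ) : ℂ) • (c ^ (2 * m + 1)) x := by
  have h1 : b (squeeze N c x) = ∑ m ∈ Finset.range N,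
      (((-1) ^ (m + 1) * ((N : ℝ) - (m + 1 : ℕ)) / (2 ^ (m + 1) * (m + 1).factorial) : ℝ) : ℂ) •
        ((2 * m + 1 : ℕ) + 1 : ℂ) • (c ^ (2 * m + 1)) x := by
    -- The index can be shifted without boundary terms: the term `m = N` has coefficient `N - m =
    -- 0`, and the term `m = 0` vanishes since `b x = 0`.
    have h2 := Finset.sum_range_succ (fun m : ℕ =>
      (((-1) ^ m * ((N : ℝ) - m) / (2 ^ m * m.factorial) : ℝ) : ℂ) • b ((c ^ (2 * m)) x)) N
    rw [Finset.sum_range_succ'] at h2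
    simp only [sub_self, mul_zero, zero_div, Complex.ofReal_zero, zero_smul, add_zero, pow_zero,
      Module.End.one_apply, hx, smul_zero] at h2
    rw [squeeze_apply, map_sum]
    simp only [map_smul]
    rw [← h2]
    refine Finset.sum_congr rfl fun m _ => ?_
    rw [show 2 * (m + 1) = (2 * m + 1) + 1 by ring, lower_pow_succ hcomm hx]
  rw [h1, squeeze_apply, map_sum, ← Finset.sum_add_distrib]
  refine Finset.sum_congr rfl fun m _ => ?_
  rw [map_smul, ← Module.End.mul_apply c, ← pow_succ', smul_smul, ← add_smul]
  congr 1
  have hm : (m.factorial : ℂ) ≠ 0 := by exact_mod_cast m.factorial_ne_zero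
  have hm1 : (m : ℂ) + 1 ≠ 0 := by exact_mod_cast m.succ_ne_zero
  rw [Nat.factorial_succ]
  push_cast
  field_simp
  ring

theorem norm_field_squeeze_sq_le {N : ℕ} (hN : 0 < N) {x : E} (hx : b x = 0) :
    ‖b (squeeze N c x) + c (squeeze N c x)‖ ^ 2 ≤ 6 / N * (squeezeNorm N * ‖x‖ ^ 2) := by
  rw [field_squeeze hadj hcomm N hx, norm_sq_sum_pow hadj hcomm hx _ (fun m => 2 * m + 1)
    (fun m n h => by simpa using h), ← mul_assoc]
  refine mul_le_mul_of_nonneg_right ?_ (by positivity)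
  refine le_trans (le_of_eq ?_) (sum_odd_weight_le N hN)
  refine Finset.sum_congr rfl fun m _ => ?_
  rw [Nat.factorial_succ, Nat.cast_mul, factorial_two_mul_eq, div_pow, ← pow_mul, mul_comm m 2,
    pow_mul]
  have : (0 : ℝ) < m.factorial := by exact_mod_cast m.factorial_pos
  field_simp
  push_cast
  norm_num
  ring

/-- Parity: the left vector has only odd powers of `c`, the right one only even powers. This removes
the cross terms between a squeezed mode and the rest of the field. -/
theorem inner_field_squeeze (N : ℕ) {x y : E} (hx : b x = 0) (hy : b y = 0) :
    inner ℂ (b (squeeze N c x) + c (squeeze N c x)) (squeeze N c y) = 0 := by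
  rw [field_squeeze hadj hcomm N hx, squeeze_apply, sum_inner]
  refine Finset.sum_eq_zero fun m _ => ?_
  rw [inner_sum]
  refine Finset.sum_eq_zero fun n _ => ?_
  rw [inner_smul_left, inner_smul_right, inner_pow_pow hadj hcomm hx hy, if_neg (by omega)]
  simp

end SingleMode

/-! ### Squeezing finitely many orthonormal modes -/

section ManyModes

variable {E : Type*} [NormedAddCommGroup E] [InnerProductSpace ℂ E]
  {ι : Type*} [Fintype ι] [DecidableEq ι]

/-- Squeeze the modes one after another, starting from the vacuum. The statement that `ann a f x =
0` for `f` orthogonal to the treated modes is what keeps the next mode in its vacuum. Reality of `⟨g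
i, f⟩` ensures that only the squeezed quadrature of mode `i` occurs in the field of `f`; the
component of `f` outside the span keeps its vacuum fluctuation. -/
theorem exists_squeezed {a ad : ι → E →ₗ[ℂ] E} (h : IsCCR a ad) (deg : ℕ → Submodule ℂ E)
    (hmono : Monotone deg) (hdeg : ∀ n g x, x ∈ deg n → cre ad g x ∈ deg (n + 1))
    (vac : E) (hvac : vac ≠ 0) (hvac0 : vac ∈ deg 0) (hann : ∀ i, a i vac = 0)
    {κ : Type*} [DecidableEq κ] (g : κ → EuclideanSpace ℂ ι) (hg : Orthonormal ℂ g)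
    {N : ℕ} (hN : 0 < N) (s : Finset κ) :
    ∃ x : E, x ≠ 0 ∧ x ∈ deg (2 * N * s.card) ∧
      (∀ f, (∀ i ∈ s, (inner ℂ (g i) f : ℂ) = 0) → ann a f x = 0) ∧
      ∀ f, (∀ i ∈ s, (inner ℂ (g i) f : ℂ).im = 0) →
        ‖ann a f x + cre ad f x‖ ^ 2 ≤
          (6 / N * ∑ i ∈ s, ‖(inner ℂ (g i) f : ℂ)‖ ^ 2 +
            ‖f - ∑ i ∈ s, (inner ℂ (g i) f : ℂ) • g i‖ ^ 2) * ‖x‖ ^ 2 := by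
  induction s using Finset.induction_on with
  | empty =>
    have h0 : ∀ f, ann a f vac = 0 := fun f => by simp [ann_apply, hann]
    refine ⟨vac, hvac, by simpa using hvac0, fun f _ => h0 f, fun f _ => ?_⟩
    rw [h0, zero_add, h.norm_cre_sq, h0]
    simp
  | insert i s his ih =>
    obtain ⟨x, hx0, hxdeg, hxann, hxX⟩ := ih
    have hgi : ∀ l ∈ s, (inner ℂ (g l) (g i) : ℂ) = 0 := fun l hl =>
      hg.2 fun hh => his (hh ▸ hl)
    have hgg : (inner ℂ (g i) (g i) : ℂ) = 1 := by
      rw [inner_self_eq_norm_sq_to_K, hg.1]; simp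
    have hadj := h.inner_cre (g i)
    have hcomm : ∀ y, ann a (g i) (cre ad (g i) y) = cre ad (g i) (ann a (g i) y) + y := by
      intro y; rw [h.ann_cre, hgg, one_smul]
    have hbx : ann a (g i) x = 0 := hxann _ hgi
    have hsq : ‖squeeze N (cre ad (g i)) x‖ ^ 2 = squeezeNorm N * ‖x‖ ^ 2 :=
      norm_squeeze_sq hadj hcomm N hbx
    have hNpos := squeezeNorm_pos hN
    have hpowdeg : ∀ m, (cre ad (g i) ^ m) x ∈ deg (2 * N * s.card + m) := by
      intro m
      induction m with
      | zero => simpa using hxdeg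
      | succ m ihm =>
        rw [pow_succ', Module.End.mul_apply, ← add_assoc]
        exact hdeg _ _ _ ihm
    refine ⟨squeeze N (cre ad (g i)) x, ?_, ?_, ?_, ?_⟩
    · intro hh
      rw [hh, norm_zero] at hsq
      have : 0 < squeezeNorm N * ‖x‖ ^ 2 := by positivity
      norm_num at hsq
      rcases hsq with h1 | h1
      · exact hNpos.ne' h1
      · exact hx0 h1
    · rw [squeeze_apply]
      refine Submodule.sum_mem _ fun m hm => Submodule.smul_mem _ _ (hmono ?_ (hpowdeg (2 * m)))
      rw [Finset.card_insert_of_notMem his, mul_add, mul_one]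
      have := Finset.mem_range.1 hm
      omega
    · intro f hf
      rw [squeeze_comm N _ (ann a f), hxann f fun l hl => hf l (Finset.mem_insert_of_mem hl),
        map_zero]
      intro y
      rw [h.ann_cre, ← inner_conj_symm, hf i (Finset.mem_insert_self i s)]
      simp
    · intro f hf
      -- Split `f` into its component along the new mode and `f' ⟂ g i`. Since `t` is real, the
      -- field of `f` is `t (b + c)` plus the field of `f'`, and the latter commutes with the
      -- squeezing operator.
      set t : ℂ := inner ℂ (g i) f with ht
      set f' := f - t • g i with hf'
      have htim : t.im = 0 := hf i (Finset.mem_insert_self i s)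
      have htconj : conj t = t := Complex.conj_eq_iff_im.2 htim
      have hff : f = t • g i + f' := by rw [hf']; abel
      have hgf' : (inner ℂ (g i) f' : ℂ) = 0 := by
        rw [hf', inner_sub_right, inner_smul_right, hgg, mul_one, sub_self]
      have hglf' : ∀ l ∈ s, (inner ℂ (g l) f' : ℂ) = inner ℂ (g l) f := by
        intro l hl
        rw [hf', inner_sub_right, inner_smul_right, hgi l hl, mul_zero, sub_zero]
      have hgf'2 : (inner ℂ f' (g i) : ℂ) = 0 := by rw [← inner_conj_symm, hgf', map_zero]
      set z := ann a f' x + cre ad f' x with hz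
      have hbz : ann a (g i) z = 0 := by
        rw [hz, map_add, h.ann_ann, hbx, h.ann_cre, hbx, hgf']
        simp
      have hX : ann a f (squeeze N (cre ad (g i)) x) + cre ad f (squeeze N (cre ad (g i)) x) =
          t • (ann a (g i) (squeeze N (cre ad (g i)) x) + cre ad (g i) (squeeze N (cre ad (g i)) x))
            + squeeze N (cre ad (g i)) z := by
        have e1 : ann a f' (squeeze N (cre ad (g i)) x) = squeeze N (cre ad (g i)) (ann a f' x) :=
          squeeze_comm N _ _ (fun y => by rw [h.ann_cre, hgf'2]; simp) x
        have e2 : cre ad f' (squeeze N (cre ad (g i)) x) = squeeze N (cre ad (g i)) (cre ad f' x) :=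
          squeeze_comm N _ _ (fun y => h.cre_cre _ _ _) x
        conv_lhs => rw [hff, ann_add, cre_add, ann_smul, cre_smul, htconj]
        rw [hz, map_add, ← e1, ← e2]
        simp only [LinearMap.add_apply, LinearMap.smul_apply]
        module
      have horth : (inner ℂ (t • (ann a (g i) (squeeze N (cre ad (g i)) x) +
          cre ad (g i) (squeeze N (cre ad (g i)) x))) (squeeze N (cre ad (g i)) z) : ℂ) = 0 := by
        rw [inner_smul_left, inner_field_squeeze hadj hcomm N hbx hbz, mul_zero]
      rw [hX, @norm_add_sq ℂ, horth, norm_smul, mul_pow,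
        norm_squeeze_sq hadj hcomm N hbz, hsq, Finset.sum_insert his, Finset.sum_insert his]
      have e1 := norm_field_squeeze_sq_le hadj hcomm hN hbx
      have e2 := hxX f' (fun l hl => by
        rw [hglf' l hl]; exact hf l (Finset.mem_insert_of_mem hl))
      have e3 : ∑ l ∈ s, ‖(inner ℂ (g l) f' : ℂ)‖ ^ 2 = ∑ l ∈ s, ‖(inner ℂ (g l) f : ℂ)‖ ^ 2 :=
        Finset.sum_congr rfl fun l hl => by rw [hglf' l hl]
      have e4 : f' - ∑ l ∈ s, (inner ℂ (g l) f' : ℂ) • g l =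
          f - (t • g i + ∑ l ∈ s, (inner ℂ (g l) f : ℂ) • g l) := by
        rw [Finset.sum_congr rfl fun l hl => by rw [hglf' l hl], hf']
        abel
      rw [e3, e4] at e2
      have e5 := mul_le_mul_of_nonneg_left e1 (sq_nonneg ‖t‖)
      have e6 := mul_le_mul_of_nonneg_left e2 hNpos.le
      simp only [map_zero, mul_zero, add_zero]
      linarith

end ManyModes

/-! ### Ladder operators in the occupation number basis -/

section Ladder

variable {ι : Type} [DecidableEq ι]

theorem sub_single_add_single {n : ι → ℕ} {i : ι} (h : n i ≠ 0) :
    n - Pi.single i 1 + Pi.single i 1 = n := by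
  funext j
  by_cases hj : j = i
  · subst hj
    simp only [Pi.add_apply, Pi.sub_apply, Pi.single_eq_same]
    omega
  · simp [Pi.single_eq_of_ne hj]

/-- The left summand is supported where `n i ≠ 0`, the range of the injective shift `n ↦ n + e_i`.
Reindexing along this shift needs no summability. -/
theorem tsum_conj_create_mul (i : ι) (v w : (ι → ℕ) → ℂ) :
    ∑' n, conj (create i v n) * w n = ∑' n, conj (v n) * annihilate i w n := by
  have hinj : Function.Injective fun n : ι → ℕ => n + Pi.single i 1 := add_left_injective _
  have hsupp : Function.support (fun n => conj (create i v n) * w n) ⊆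
      Set.range fun n : ι → ℕ => n + Pi.single i 1 := by
    intro n hn
    have hni : n i ≠ 0 := by
      rintro h0
      simp [create, h0] at hn
    refine ⟨n - Pi.single i 1, ?_⟩
    exact sub_single_add_single hni
  rw [← hinj.tsum_eq hsupp]
  refine tsum_congr fun n => ?_
  simp [create, annihilate]
  ring

theorem annihilate_create (i j : ι) (v : (ι → ℕ) → ℂ) :
    annihilate i (create j v) = create j (annihilate i v) + if i = j then v else 0 := by
  funext n
  by_cases hij : i = j
  · subst hij
    by_cases h0 : n i = 0
    · simp [annihilate, create, h0]
    · have h1 : n - Pi.single i 1 + Pi.single i 1 = n :=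
        sub_single_add_single h0
      have h2 : ((n i - 1 : ℕ) : ℝ) + 1 = n i := by
        rw [Nat.cast_sub (Nat.one_le_iff_ne_zero.2 h0)]; simp
      simp only [annihilate, create, Pi.add_apply, Pi.single_eq_same, if_true, Pi.sub_apply, h1, h2,
        add_tsub_cancel_right]
      rw [← mul_assoc, ← mul_assoc, ← Complex.ofReal_mul, ← Complex.ofReal_mul, Nat.cast_add,
        Nat.cast_one, Real.mul_self_sqrt (by positivity), Real.mul_self_sqrt (by positivity)]
      push_cast
      ring
  · by_cases h0 : n j = 0
    · simp [annihilate, create, h0, hij, Ne.symm hij]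
    · have h1 : n + Pi.single i 1 - Pi.single j 1 = n - Pi.single j 1 + Pi.single i 1 :=
        by
        conv_lhs => rw [← sub_single_add_single h0]
        rw [add_right_comm, add_tsub_cancel_right]
      simp only [annihilate, create, Pi.add_apply, Pi.sub_apply, h1, if_neg hij, Pi.zero_apply,
        add_zero, Pi.single_eq_of_ne hij, Pi.single_eq_of_ne (Ne.symm hij), tsub_zero]
      ring

theorem annihilate_annihilate (i j : ι) (v : (ι → ℕ) → ℂ) :
    annihilate i (annihilate j v) = annihilate j (annihilate i v) := by
  funext n
  by_cases hij : i = j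
  · rw [hij]
  · simp only [annihilate, Pi.add_apply, Pi.single_eq_of_ne hij, Pi.single_eq_of_ne (Ne.symm hij),
      add_zero, add_right_comm n (Pi.single i 1) (Pi.single j 1)]
    ring

theorem annihilate_add (i : ι) (v w : (ι → ℕ) → ℂ) :
    annihilate i (v + w) = annihilate i v + annihilate i w := by
  funext n; simp [annihilate, mul_add]

theorem annihilate_smul (i : ι) (c : ℂ) (v : (ι → ℕ) → ℂ) :
    annihilate i (c • v) = c • annihilate i v := by
  funext n; simp [annihilate]; ring

theorem create_add (i : ι) (v w : (ι → ℕ) → ℂ) :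
    create i (v + w) = create i v + create i w := by
  funext n; simp [create, mul_add]

theorem create_smul (i : ι) (c : ℂ) (v : (ι → ℕ) → ℂ) :
    create i (c • v) = c • create i v := by
  funext n; simp [create]; ring

theorem finite_annihilate {s : Set (ι → ℕ)} (hs : s.Finite) (i : ι) :
    {n : ι → ℕ | n + Pi.single i 1 ∈ s}.Finite :=
  hs.preimage (add_left_injective _).injOn

theorem finite_create {s : Set (ι → ℕ)} (hs : s.Finite) (i : ι) :
    {n : ι → ℕ | n i ≠ 0 ∧ n - Pi.single i 1 ∈ s}.Finite := by
  refine (hs.image (· + Pi.single i 1)).subset fun n hn => ⟨_, hn.2, ?_⟩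
  exact sub_single_add_single hn.1

end Ladder

/-! ### Finite particle vectors as an inner product space -/

section FockSpace

variable (ι : Type)

/-- The finitely supported Fock vectors. -/
def finiteParticle : Submodule ℂ ((ι → ℕ) → ℂ) where
  carrier := {v | v.support.Finite}
  add_mem' ha hb := (ha.union hb).subset (Function.support_add _ _)
  zero_mem' := by simp
  smul_mem' c _ hv := hv.subset (Function.support_const_smul_subset c _)

/-- The finitely supported Fock vectors, as a type. -/
def FockSpace : Type := finiteParticle ι

instance : AddCommGroup (FockSpace ι) := inferInstanceAs (AddCommGroup (finiteParticle ι))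
instance : Module ℂ (FockSpace ι) := inferInstanceAs (Module ℂ (finiteParticle ι))

variable {ι}

theorem FockSpace.summable (v w : FockSpace ι) :
    Summable fun n => conj (v.1 n) * w.1 n :=
  summable_of_hasFiniteSupport (w.2.subset fun n hn => by
    rw [Function.mem_support] at hn ⊢
    exact right_ne_zero_of_mul hn)

/-- The inner product of Fock space. -/
@[reducible] def FockSpace.core : InnerProductSpace.Core ℂ (FockSpace ι) where
  inner v w := ∑' n, conj (v.1 n) * w.1 n
  conj_inner_symm v w := by
    rw [Complex.conj_tsum]
    exact tsum_congr fun n => by simp [mul_comm]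
  re_inner_nonneg v := by
    have h : ∀ n, conj (v.1 n) * v.1 n = ((‖v.1 n‖ ^ 2 : ℝ) : ℂ) := fun n => by
      rw [Complex.conj_mul']; push_cast; rfl
    simp only [h, ← Complex.ofReal_tsum]
    exact tsum_nonneg fun n => by positivity
  add_left u v w := by
    rw [← (FockSpace.summable u w).tsum_add (FockSpace.summable v w)]
    refine tsum_congr fun n => ?_
    change conj (u.1 n + v.1 n) * w.1 n = _
    rw [map_add, add_mul]
  smul_left v w r := by
    rw [← tsum_mul_left]
    refine tsum_congr fun n => ?_
    change conj (r * v.1 n) * w.1 n = _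
    rw [map_mul, mul_assoc]
  definite v hv := by
    have h : ∀ n, conj (v.1 n) * v.1 n = ((‖v.1 n‖ ^ 2 : ℝ) : ℂ) := fun n => by
      rw [Complex.conj_mul']; push_cast; rfl
    have hs := FockSpace.summable v v
    simp only [h, ← Complex.ofReal_tsum, Complex.ofReal_eq_zero] at hv
    simp only [h, Complex.summable_ofReal] at hs
    have hv' := (hasSum_zero_iff_of_nonneg fun n => by positivity).1 (hv ▸ hs.hasSum)
    apply Subtype.ext
    funext n
    have := congrFun hv' n
    have h0 : v.1 n = 0 := by simpa using this
    exact h0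

instance : NormedAddCommGroup (FockSpace ι) := FockSpace.core.toNormedAddCommGroup
instance : InnerProductSpace ℂ (FockSpace ι) := InnerProductSpace.ofCore FockSpace.core.toCore

variable [DecidableEq ι]

/-- The annihilation operator on finite particle vectors. -/
def fockAnn (i : ι) : FockSpace ι →ₗ[ℂ] FockSpace ι where
  toFun v := ⟨annihilate i v.1, (finite_annihilate v.2 i).subset fun n hn => by
    exact right_ne_zero_of_mul (Function.mem_support.1 hn)⟩
  map_add' v w := Subtype.ext (annihilate_add i v.1 w.1)
  map_smul' c v := Subtype.ext (annihilate_smul i c v.1)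

/-- The creation operator on finite particle vectors. -/
def fockCre (i : ι) : FockSpace ι →ₗ[ℂ] FockSpace ι where
  toFun v := ⟨create i v.1, (finite_create v.2 i).subset fun n hn => by
    have h := Function.mem_support.1 hn
    refine ⟨fun h0 => h ?_, right_ne_zero_of_mul h⟩
    simp [create, h0]⟩
  map_add' v w := Subtype.ext (create_add i v.1 w.1)
  map_smul' c v := Subtype.ext (create_smul i c v.1)

theorem fock_isCCR : IsCCR (fockAnn (ι := ι)) fockCre where
  adj i x y := tsum_conj_create_mul i x.1 y.1
  comm i j x := by
    apply Subtype.ext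
    refine (annihilate_create i j x.1).trans ?_
    by_cases h : i = j
    · simp only [if_pos h]; rfl
    · simp only [if_neg h]; rfl
  comm_ann i j x := Subtype.ext (annihilate_annihilate i j x.1)

/-- The vacuum. -/
def vacuum : FockSpace ι := 
  ⟨Set.indicator {0} 1, (Set.finite_singleton (0 : ι → ℕ)).subset Set.support_indicator_subset⟩

theorem vacuum_ne_zero : (vacuum : FockSpace ι) ≠ 0 := by
  intro h
  have := congrFun (congrArg Subtype.val h) 0
  change Set.indicator {0} (1 : (ι → ℕ) → ℂ) 0 = 0 at this
  simp at this

theorem fockAnn_vacuum (i : ι) : fockAnn i vacuum = 0 := by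
  apply Subtype.ext
  funext n
  have : n + Pi.single i 1 ≠ 0 := fun h => by simpa using congrFun h i
  change ((Real.sqrt ((n i : ℝ) + 1) : ℝ) : ℂ) * Set.indicator {0} (1 : (ι → ℕ) → ℂ) _ = 0
  rw [Set.indicator_of_notMem (s := {(0 : ι → ℕ)}) this, mul_zero]

variable [Fintype ι]

/-- Vectors with at most `d` particles. -/
def atMost (d : ℕ) : Submodule ℂ (FockSpace ι) where
  carrier := {v | ∀ n, v.1 n ≠ 0 → ∑ i, n i ≤ d}
  add_mem' {a b} ha hb n hn := by
    by_cases h : a.1 n = 0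
    · refine hb n fun h' => hn ?_
      change a.1 n + b.1 n = 0
      rw [h, h', add_zero]
    · exact ha n h
  zero_mem' n hn := absurd rfl hn
  smul_mem' c a ha n hn := ha n (right_ne_zero_of_mul (a := c) hn)

theorem atMost_mono : Monotone (atMost (ι := ι)) := fun _ _ h _ hv n hn => (hv n hn).trans h

theorem fockCre_mem_atMost (d : ℕ) (i : ι) (v : FockSpace ι) (hv : v ∈ atMost d) :
    fockCre i v ∈ atMost (d + 1) := by
  intro n hn
  have hn' : ((Real.sqrt (n i : ℝ) : ℝ) : ℂ) * v.1 (n - Pi.single i 1) ≠ 0 := hn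
  have h1 := hv _ (right_ne_zero_of_mul hn')
  have h2 : n i ≠ 0 := fun h0 => hn' (by simp [h0])
  have h3 : n - Pi.single i 1 + Pi.single i 1 = n :=
    sub_single_add_single h2
  rw [← h3]
  simp only [Pi.add_apply, Finset.sum_add_distrib]
  have h4 : ∑ j, (Pi.single i 1 : ι → ℕ) j = 1 := by simp
  omega

theorem cre_mem_atMost (d : ℕ) (g : EuclideanSpace ℂ ι) (v : FockSpace ι) (hv : v ∈ atMost d) :
    cre fockCre g v ∈ atMost (d + 1) := by
  rw [cre_apply]
  exact Submodule.sum_mem _ fun i _ => Submodule.smul_mem _ _ (fockCre_mem_atMost d i v hv)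

theorem FockSpace.norm_sq (v : FockSpace ι) : ‖v‖ ^ 2 = ∑' n, ‖v.1 n‖ ^ 2 := by
  have h : (inner ℂ v v : ℂ) = ((∑' n, ‖v.1 n‖ ^ 2 : ℝ) : ℂ) := by
    rw [Complex.ofReal_tsum]
    refine tsum_congr fun n => ?_
    rw [Complex.conj_mul']; push_cast; rfl
  rw [inner_self_eq_norm_sq_to_K] at h
  apply Complex.ofReal_injective
  rw [← h]
  push_cast
  rfl

/-- The left side is the expectation of the number operator, which is diagonal with eigenvalue `∑ i,
n i` on `|n⟩`. -/
theorem sum_norm_fockAnn_sq_le (d : ℕ) (v : FockSpace ι) (hv : v ∈ atMost d) :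
    ∑ i, ‖fockAnn i v‖ ^ 2 ≤ d * ‖v‖ ^ 2 := by
  have h1 : ∀ i, (‖fockAnn i v‖ ^ 2 : ℝ) = ∑' n, (n i : ℝ) * ‖v.1 n‖ ^ 2 := by
    intro i
    have h2 : (inner ℂ (fockAnn i v) (fockAnn i v) : ℂ) =
        ((∑' n, (n i : ℝ) * ‖v.1 n‖ ^ 2 : ℝ) : ℂ) := by
      rw [fock_isCCR.adj', Complex.ofReal_tsum]
      refine tsum_congr fun n => ?_
      change conj (v.1 n) * create i (annihilate i v.1) n = _
      by_cases h0 : n i = 0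
      · simp [create, h0]
      · have h3 : n - Pi.single i 1 + Pi.single i 1 = n :=
          sub_single_add_single h0
        have h4 : ((n i - 1 : ℕ) : ℝ) + 1 = n i := by
          rw [Nat.cast_sub (Nat.one_le_iff_ne_zero.2 h0)]; simp
        simp only [create, annihilate, h3, Pi.sub_apply, Pi.single_eq_same, h4]
        rw [← mul_assoc ((√(n i : ℝ) : ℝ) : ℂ), ← Complex.ofReal_mul,
          Real.mul_self_sqrt (by positivity), mul_left_comm, Complex.conj_mul']
        push_cast
        rfl
    rw [inner_self_eq_norm_sq_to_K] at h2
    apply Complex.ofReal_injective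
    rw [← h2]
    push_cast
    rfl
  have hfin : ∀ f : (ι → ℕ) → ℝ, Summable fun n => f n * ‖v.1 n‖ ^ 2 := fun f =>
    summable_of_hasFiniteSupport (v.2.subset fun n hn => by
      intro h0
      apply hn
      simp [h0])
  simp only [h1]
  rw [← Summable.tsum_finsetSum fun i _ => hfin _, FockSpace.norm_sq, ← tsum_mul_left]
  refine Summable.tsum_le_tsum (fun n => ?_) (summable_sum fun i _ => hfin _) (hfin _)
  rw [← Finset.sum_mul]
  by_cases h0 : v.1 n = 0
  · simp [h0]
  · refine mul_le_mul_of_nonneg_right ?_ (by positivity)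
    exact_mod_cast hv n h0

end FockSpace

/-! ### The core as an inner product space -/

section CoreSpace

variable {L Λ : ℝ} {hL : 0 < L}

namespace IsCore

theorem zero : IsCore (0 : Wave L Λ hL) where
  smooth n := contDiff_const
  compact n := HasCompactSupport.zero
  finite := by simp

theorem add {Φ Ψ : Wave L Λ hL} (hΦ : IsCore Φ) (hΨ : IsCore Ψ) : IsCore (Φ + Ψ) where
  smooth n := (hΦ.smooth n).add (hΨ.smooth n)
  compact n := (hΦ.compact n).add (hΨ.compact n)
  finite := by
    refine (hΦ.finite.union hΨ.finite).subset ?_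
    rintro n ⟨x, hx⟩
    by_cases h : Φ x n = 0
    · refine Or.inr ⟨x, fun h' => hx ?_⟩
      simp [h, h']
    · exact Or.inl ⟨x, h⟩

theorem smul (c : ℂ) {Ψ : Wave L Λ hL} (hΨ : IsCore Ψ) : IsCore (c • Ψ) where
  smooth n := contDiff_const.mul (hΨ.smooth n)
  compact n := (hΨ.compact n).mul_left (f := fun _ => c)
  finite := by
    refine hΨ.finite.subset ?_
    rintro n ⟨x, hx⟩
    exact ⟨x, right_ne_zero_of_mul (a := c) hx⟩

theorem eq_zero {Ψ : Wave L Λ hL} (hΨ : IsCore Ψ) {n : Mode L Λ hL → ℕ}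
    (hn : n ∉ hΨ.finite.toFinset) (x : Space) : Ψ x n = 0 := by
  by_contra h
  exact hn (hΨ.finite.mem_toFinset.2 ⟨x, h⟩)

theorem tsum_eq (Φ : Wave L Λ hL) {Ψ : Wave L Λ hL} (hΨ : IsCore Ψ) (x : Space) :
    ∑' n, conj (Φ x n) * Ψ x n = ∑ n ∈ hΨ.finite.toFinset, conj (Φ x n) * Ψ x n :=
  tsum_eq_sum fun n hn => by rw [hΨ.eq_zero hn, mul_zero]

theorem continuous_conj_mul {Φ Ψ : Wave L Λ hL} (hΦ : IsCore Φ) (hΨ : IsCore Ψ)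
    (n : Mode L Λ hL → ℕ) : Continuous fun x => conj (Φ x n) * Ψ x n :=
  (Complex.continuous_conj.comp (hΦ.smooth n).continuous).mul (hΨ.smooth n).continuous

theorem integrable_conj_mul {Φ Ψ : Wave L Λ hL} (hΦ : IsCore Φ) (hΨ : IsCore Ψ)
    (n : Mode L Λ hL → ℕ) : Integrable fun x => conj (Φ x n) * Ψ x n :=
  (hΦ.continuous_conj_mul hΨ n).integrable_of_hasCompactSupport
    ((hΨ.compact n).mul_left (f := fun x => conj (Φ x n)))

theorem integrable_tsum {Φ Ψ : Wave L Λ hL} (hΦ : IsCore Φ) (hΨ : IsCore Ψ) :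
    Integrable fun x => ∑' n, conj (Φ x n) * Ψ x n := by
  simp only [tsum_eq Φ hΨ]
  exact integrable_finsetSum _ fun n _ => hΦ.integrable_conj_mul hΨ n

/-- The freedom to enlarge `s` lets two inner products be compared term by term over a common finite
set, as in the integration by parts for the momentum. -/
theorem innerProduct_eq {Φ Ψ : Wave L Λ hL} (hΦ : IsCore Φ) (hΨ : IsCore Ψ)
    {s : Finset (Mode L Λ hL → ℕ)} (hs : hΨ.finite.toFinset ⊆ s) :
    innerProduct Φ Ψ = ∑ n ∈ s, ∫ x, conj (Φ x n) * Ψ x n := by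
  rw [innerProduct, ← integral_finsetSum _ fun n _ => hΦ.integrable_conj_mul hΨ n]
  congr 1
  funext x
  exact tsum_eq_sum fun n hn => by rw [hΨ.eq_zero fun h => hn (hs h), mul_zero]

theorem ladder_lower {Ψ : Wave L Λ hL} (hΨ : IsCore Ψ) (m : Mode L Λ hL) {u : Space → ℂ}
    (hu : ContDiff ℝ ∞ u) : IsCore fun x n => u x * annihilate m (Ψ x) n where
  smooth n := hu.mul (contDiff_const.mul (hΨ.smooth _))
  compact n := ((hΨ.compact _).mul_left (f := fun _ => _)).mul_left (f := u)
  finite := by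
    refine (finite_annihilate hΨ.finite m).subset ?_
    rintro n ⟨x, hx⟩
    exact ⟨x, right_ne_zero_of_mul (right_ne_zero_of_mul hx)⟩

theorem ladder_raise {Ψ : Wave L Λ hL} (hΨ : IsCore Ψ) (m : Mode L Λ hL) {u : Space → ℂ}
    (hu : ContDiff ℝ ∞ u) : IsCore fun x n => u x * create m (Ψ x) n where
  smooth n := hu.mul (contDiff_const.mul (hΨ.smooth _))
  compact n := ((hΨ.compact _).mul_left (f := fun _ => _)).mul_left (f := u)
  finite := by
    refine (finite_create hΨ.finite m).subset ?_
    rintro n ⟨x, hx⟩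
    refine ⟨fun h0 => right_ne_zero_of_mul hx ?_, x,
      right_ne_zero_of_mul (right_ne_zero_of_mul hx)⟩
    simp [create, h0]

theorem differentiable {Ψ : Wave L Λ hL} (hΨ : IsCore Ψ) (n : Mode L Λ hL → ℕ) :
    Differentiable ℝ fun x => Ψ x n := (hΨ.smooth n).differentiable (by simp)

theorem momentum {Ψ : Wave L Λ hL} (hΨ : IsCore Ψ) (j : Fin 3) :
    IsCore (NonRelQED.momentum j Ψ) where
  smooth n := contDiff_const.mul
    (((hΨ.smooth n).fderiv_right (m := ∞) (by simp)).clm_apply contDiff_const)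
  compact n := by
    refine HasCompactSupport.mul_left (f := fun _ => _) ?_
    exact (hΨ.compact n).fderiv_apply (𝕜 := ℝ) _
  finite := by
    refine hΨ.finite.subset ?_
    rintro n ⟨x, hx⟩
    by_contra h
    have h0 : (fun y => Ψ y n) = fun _ => 0 := by
      funext y
      by_contra h'
      exact h ⟨y, h'⟩
    apply hx
    simp [NonRelQED.momentum, h0]

end IsCore

variable (L Λ hL) in
/-- The core `C_c^∞(ℝ³) ⊗ ℱ_fin` as a subspace. -/
def coreSubmodule : Submodule ℂ (Wave L Λ hL) where
  carrier := {Ψ | IsCore Ψ}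
  add_mem' := IsCore.add
  zero_mem' := IsCore.zero
  smul_mem' c _ h := IsCore.smul c h

variable (L Λ hL) in
/-- The core as a type. -/
def CoreSpace : Type := coreSubmodule L Λ hL

instance : AddCommGroup (CoreSpace L Λ hL) := inferInstanceAs (AddCommGroup (coreSubmodule L Λ hL))
instance : Module ℂ (CoreSpace L Λ hL) := inferInstanceAs (Module ℂ (coreSubmodule L Λ hL))

theorem CoreSpace.isCore (Ψ : CoreSpace L Λ hL) : IsCore Ψ.1 := Ψ.2

theorem tsum_conj_mul_self (v : (Mode L Λ hL → ℕ) → ℂ) :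
    ∑' n, conj (v n) * v n = ((∑' n, ‖v n‖ ^ 2 : ℝ) : ℂ) := by
  rw [Complex.ofReal_tsum]
  exact tsum_congr fun n => by rw [Complex.conj_mul']; push_cast; rfl

theorem innerProduct_self (Ψ : Wave L Λ hL) :
    innerProduct Ψ Ψ = ((∫ x, ∑' n, ‖Ψ x n‖ ^ 2 : ℝ) : ℂ) := by
  simp only [innerProduct, tsum_conj_mul_self]
  exact integral_ofReal

/-- The inner product of the core. -/
@[reducible] def CoreSpace.core : InnerProductSpace.Core ℂ (CoreSpace L Λ hL) where
  inner Φ Ψ := innerProduct Φ.1 Ψ.1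
  conj_inner_symm Φ Ψ := by
    rw [innerProduct, ← integral_conj]
    refine integral_congr_ae (Filter.Eventually.of_forall fun x => ?_)
    change conj (∑' n, conj (Ψ.1 x n) * Φ.1 x n) = ∑' n, conj (Φ.1 x n) * Ψ.1 x n
    rw [Complex.conj_tsum]
    exact tsum_congr fun n => by simp [mul_comm]
  re_inner_nonneg Ψ := by
    rw [innerProduct_self, RCLike.re_to_complex, Complex.ofReal_re]
    exact integral_nonneg fun x => tsum_nonneg fun n => by positivity
  add_left Φ Ψ Θ := by
    rw [innerProduct, innerProduct, innerProduct,
      ← integral_add (Φ.isCore.integrable_tsum Θ.isCore) (Ψ.isCore.integrable_tsum Θ.isCore)]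
    congr 1
    funext x
    rw [Θ.isCore.tsum_eq, Θ.isCore.tsum_eq, Θ.isCore.tsum_eq, ← Finset.sum_add_distrib]
    refine Finset.sum_congr rfl fun n _ => ?_
    change conj (Φ.1 x n + Ψ.1 x n) * Θ.1 x n = _
    rw [map_add, add_mul]
  smul_left Φ Ψ c := by
    rw [innerProduct, innerProduct, ← integral_const_mul]
    congr 1
    funext x
    rw [← tsum_mul_left]
    refine tsum_congr fun n => ?_
    change conj (c * Φ.1 x n) * Ψ.1 x n = _
    rw [map_mul, mul_assoc]
  definite Ψ h := by
    have hsum : ∀ x, ∑' n, ‖Ψ.1 x n‖ ^ 2 =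
        ∑ n ∈ Ψ.isCore.finite.toFinset, ‖Ψ.1 x n‖ ^ 2 := fun x =>
      tsum_eq_sum fun n hn => by rw [Ψ.isCore.eq_zero hn]; simp
    have hint := (Ψ.isCore.integrable_tsum Ψ.isCore)
    rw [innerProduct_self, Complex.ofReal_eq_zero] at h
    simp only [tsum_conj_mul_self] at hint
    have hint' : Integrable fun x => ∑' n, ‖Ψ.1 x n‖ ^ 2 := by
      simpa using hint.re
    rw [integral_eq_zero_iff_of_nonneg (fun x => tsum_nonneg fun n => by positivity) hint'] at h
    have hcont : Continuous fun x => ∑' n, ‖Ψ.1 x n‖ ^ 2 := by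
      simp only [hsum]
      exact continuous_finsetSum _ fun n _ => ((Ψ.isCore.smooth n).continuous.norm).pow 2
    rw [hcont.ae_eq_iff_eq volume continuous_zero] at h
    apply Subtype.ext
    funext x n
    by_cases hn : n ∈ Ψ.isCore.finite.toFinset
    · have h1 := congrFun h x
      simp only [hsum, Pi.zero_apply] at h1
      rw [Finset.sum_eq_zero_iff_of_nonneg fun n _ => by positivity] at h1
      have h2 : Ψ.1 x n = 0 := by simpa using h1 n hn
      exact h2
    · exact Ψ.isCore.eq_zero hn x

instance : NormedAddCommGroup (CoreSpace L Λ hL) := CoreSpace.core.toNormedAddCommGroup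
instance : InnerProductSpace ℂ (CoreSpace L Λ hL) := InnerProductSpace.ofCore CoreSpace.core.toCore

theorem CoreSpace.inner_def (Φ Ψ : CoreSpace L Λ hL) :
    inner ℂ Φ Ψ = innerProduct Φ.1 Ψ.1 := rfl

/-! ### The operators on the core -/

/-- The plane wave of a mode. -/
def planeWave (m : Mode L Λ hL) (x : Space) : ℂ := Complex.exp (Complex.I * (inner ℝ m.k x : ℝ))

theorem conj_planeWave (m : Mode L Λ hL) (x : Space) :
    conj (planeWave m x) = Complex.exp (-Complex.I * (inner ℝ m.k x : ℝ)) := by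
  rw [planeWave, ← Complex.exp_conj, map_mul, Complex.conj_I, Complex.conj_ofReal]

theorem conj_planeWave_mul (m : Mode L Λ hL) (x : Space) :
    conj (planeWave m x) * planeWave m x = 1 := by
  rw [conj_planeWave, planeWave, ← Complex.exp_add]
  simp

theorem contDiff_planeWave (m : Mode L Λ hL) : ContDiff ℝ ∞ (planeWave m) := by
  unfold planeWave
  refine Complex.contDiff_exp.comp (contDiff_const.mul ?_)
  exact Complex.ofRealCLM.contDiff.comp (contDiff_const.inner ℝ contDiff_id)

theorem contDiff_conj_planeWave (m : Mode L Λ hL) :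
    ContDiff ℝ ∞ fun x => conj (planeWave m x) :=
  Complex.conjCLE.contDiff.comp (contDiff_planeWave m)

theorem hasFDerivAt_planeWave (m : Mode L Λ hL) (x : Space) :
    ∃ D : Space →L[ℝ] ℂ, HasFDerivAt (planeWave m) D x ∧
      ∀ j, D (EuclideanSpace.single j 1) = Complex.I * m.k j * planeWave m x := by
  have h1 : HasFDerivAt (fun x : Space => ((inner ℝ m.k x : ℝ) : ℂ))
      (Complex.ofRealCLM.comp (innerSL ℝ m.k)) x :=
    (Complex.ofRealCLM.comp (innerSL ℝ m.k)).hasFDerivAt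
  have h2 := (h1.const_mul Complex.I).cexp
  refine ⟨_, h2, fun j => ?_⟩
  simp [planeWave, EuclideanSpace.inner_single_right]
  ring

/-- The operator `e^{ikx} a` of a mode. -/
def waveAnn (m : Mode L Λ hL) : CoreSpace L Λ hL →ₗ[ℂ] CoreSpace L Λ hL where
  toFun Ψ := ⟨fun x n => planeWave m x * annihilate m (Ψ.1 x) n,
    Ψ.isCore.ladder_lower m (contDiff_planeWave m)⟩
  map_add' Φ Ψ := by
    apply Subtype.ext; funext x n
    change planeWave m x * annihilate m (Φ.1 x + Ψ.1 x) n =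
      planeWave m x * annihilate m (Φ.1 x) n + planeWave m x * annihilate m (Ψ.1 x) n
    rw [annihilate_add, Pi.add_apply, mul_add]
  map_smul' c Ψ := by
    apply Subtype.ext; funext x n
    change planeWave m x * annihilate m (c • Ψ.1 x) n = c * (planeWave m x * annihilate m (Ψ.1 x) n)
    rw [annihilate_smul, Pi.smul_apply, smul_eq_mul]; ring

/-- The operator `e^{-ikx} a^*` of a mode. -/
def waveCre (m : Mode L Λ hL) : CoreSpace L Λ hL →ₗ[ℂ] CoreSpace L Λ hL where
  toFun Ψ := ⟨fun x n => conj (planeWave m x) * create m (Ψ.1 x) n,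
    Ψ.isCore.ladder_raise m (contDiff_conj_planeWave m)⟩
  map_add' Φ Ψ := by
    apply Subtype.ext; funext x n
    change conj (planeWave m x) * create m (Φ.1 x + Ψ.1 x) n =
      conj (planeWave m x) * create m (Φ.1 x) n + conj (planeWave m x) * create m (Ψ.1 x) n
    rw [create_add, Pi.add_apply, mul_add]
  map_smul' c Ψ := by
    apply Subtype.ext; funext x n
    change conj (planeWave m x) * create m (c • Ψ.1 x) n =
      c * (conj (planeWave m x) * create m (Ψ.1 x) n)
    rw [create_smul, Pi.smul_apply, smul_eq_mul]; ring

/-- The momentum on the core. -/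
def waveMomentum (j : Fin 3) : CoreSpace L Λ hL →ₗ[ℂ] CoreSpace L Λ hL where
  toFun Ψ := ⟨momentum j Ψ.1, Ψ.isCore.momentum j⟩
  map_add' Φ Ψ := by
    apply Subtype.ext; funext x n
    change -Complex.I * fderiv ℝ ((fun y => Φ.1 y n) + fun y => Ψ.1 y n) x _ = _ + _
    rw [fderiv_add (Φ.isCore.differentiable n x) (Ψ.isCore.differentiable n x),
      _root_.add_apply, mul_add]
    rfl
  map_smul' c Ψ := by
    apply Subtype.ext; funext x n
    change -Complex.I * fderiv ℝ (c • fun y => Ψ.1 y n) x _ = c * _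
    rw [fderiv_const_smul (Ψ.isCore.differentiable n x), _root_.smul_apply,
      smul_eq_mul, mul_left_comm]
    rfl

theorem wave_isCCR : IsCCR (waveAnn (L := L) (Λ := Λ) (hL := hL)) waveCre where
  adj m Φ Ψ := by
    simp only [CoreSpace.inner_def, innerProduct]
    congr 1
    funext x
    change ∑' n, conj (conj (planeWave m x) * create m (Φ.1 x) n) * Ψ.1 x n =
      ∑' n, conj (Φ.1 x n) * (planeWave m x * annihilate m (Ψ.1 x) n)
    simp only [map_mul, Complex.conj_conj, mul_assoc, mul_left_comm _ (planeWave m x), tsum_mul_left]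
    rw [tsum_conj_create_mul]
  comm i j Ψ := by
    apply Subtype.ext; funext x n
    have h := congrFun (annihilate_create i j (Ψ.1 x)) n
    have h1 : planeWave i x * annihilate i (conj (planeWave j x) • create j (Ψ.1 x)) n =
        conj (planeWave j x) * create j (planeWave i x • annihilate i (Ψ.1 x)) n +
          (if i = j then Ψ.1 x else 0) n := by
      rw [annihilate_smul, create_smul, Pi.smul_apply, Pi.smul_apply, smul_eq_mul, smul_eq_mul, h]
      by_cases hij : i = j
      · subst hij
        simp only [if_true, Pi.add_apply]
        linear_combination (Ψ.1 x n) * conj_planeWave_mul i x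
      · simp only [if_neg hij, Pi.add_apply, Pi.zero_apply]
        ring
    refine h1.trans ?_
    by_cases hij : i = j
    · simp only [if_pos hij]; rfl
    · simp only [if_neg hij]; rfl
  comm_ann i j Ψ := by
    apply Subtype.ext; funext x n
    have h := congrFun (annihilate_annihilate i j (Ψ.1 x)) n
    change planeWave i x * annihilate i (planeWave j x • annihilate j (Ψ.1 x)) n =
      planeWave j x * annihilate j (planeWave i x • annihilate i (Ψ.1 x)) n
    rw [annihilate_smul, annihilate_smul, Pi.smul_apply, Pi.smul_apply, smul_eq_mul, smul_eq_mul, h]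
    ring

/-- Differentiating the plane wave produces the recoil `k` of the electron. -/
theorem waveMomentum_waveAnn (j : Fin 3) (m : Mode L Λ hL) (Ψ : CoreSpace L Λ hL) :
    waveMomentum j (waveAnn m Ψ) =
      waveAnn m (waveMomentum j Ψ) + ((m.k j : ℝ) : ℂ) • waveAnn m Ψ := by
  apply Subtype.ext; funext x n
  obtain ⟨D, hD, hDj⟩ := hasFDerivAt_planeWave m x
  have h1 := hD.fun_mul (((Ψ.isCore.differentiable (n + Pi.single m 1) x).hasFDerivAt).const_mul
    ((Real.sqrt ((n m : ℝ) + 1) : ℝ) : ℂ))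
  change -Complex.I * fderiv ℝ (fun x => planeWave m x *
      (((Real.sqrt ((n m : ℝ) + 1) : ℝ) : ℂ) * Ψ.1 x (n + Pi.single m 1))) x _ =
    planeWave m x * (((Real.sqrt ((n m : ℝ) + 1) : ℝ) : ℂ) * (-Complex.I * fderiv ℝ
      (fun x => Ψ.1 x (n + Pi.single m 1)) x _)) + ((m.k j : ℝ) : ℂ) * (planeWave m x *
      (((Real.sqrt ((n m : ℝ) + 1) : ℝ) : ℂ) * Ψ.1 x (n + Pi.single m 1)))
  rw [HasFDerivAt.fderiv h1]
  simp only [_root_.add_apply, _root_.smul_apply, smul_eq_mul, hDj]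
  linear_combination (-(m.k j : ℂ) * planeWave m x *
    (((Real.sqrt ((n m : ℝ) + 1) : ℝ) : ℂ) * Ψ.1 x (n + Pi.single m 1))) * Complex.I_mul_I

theorem waveMomentum_waveCre (j : Fin 3) (m : Mode L Λ hL) (Ψ : CoreSpace L Λ hL) :
    waveMomentum j (waveCre m Ψ) =
      waveCre m (waveMomentum j Ψ) - ((m.k j : ℝ) : ℂ) • waveCre m Ψ := by
  apply Subtype.ext; funext x n
  obtain ⟨D, hD, hDj⟩ := hasFDerivAt_planeWave m x
  have hDc : HasFDerivAt (fun x => conj (planeWave m x))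
      ((Complex.conjCLE : ℂ →L[ℝ] ℂ).comp D) x :=
    (Complex.conjCLE : ℂ →L[ℝ] ℂ).hasFDerivAt.comp x hD
  have h1 := hDc.fun_mul (((Ψ.isCore.differentiable (n - Pi.single m 1) x).hasFDerivAt).const_mul
    ((Real.sqrt (n m : ℝ) : ℝ) : ℂ))
  change -Complex.I * fderiv ℝ (fun x => conj (planeWave m x) *
      (((Real.sqrt (n m : ℝ) : ℝ) : ℂ) * Ψ.1 x (n - Pi.single m 1))) x _ =
    conj (planeWave m x) * (((Real.sqrt (n m : ℝ) : ℝ) : ℂ) * (-Complex.I * fderiv ℝ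
      (fun x => Ψ.1 x (n - Pi.single m 1)) x _)) - ((m.k j : ℝ) : ℂ) * (conj (planeWave m x) *
      (((Real.sqrt (n m : ℝ) : ℝ) : ℂ) * Ψ.1 x (n - Pi.single m 1)))
  rw [HasFDerivAt.fderiv h1]
  simp only [_root_.add_apply, _root_.smul_apply, smul_eq_mul,
    ContinuousLinearMap.comp_apply, hDj, ContinuousLinearEquiv.coe_coe, Complex.conjCLE_apply,
    map_mul, Complex.conj_I, Complex.conj_ofReal]
  linear_combination ((m.k j : ℂ) * conj (planeWave m x) *
    (((Real.sqrt (n m : ℝ) : ℝ) : ℂ) * Ψ.1 x (n - Pi.single m 1))) * Complex.I_mul_I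

theorem inner_waveMomentum (j : Fin 3) (Φ Ψ : CoreSpace L Λ hL) :
    inner ℂ (waveMomentum j Φ) Ψ = inner ℂ Φ (waveMomentum j Ψ) := by
  classical
  simp only [CoreSpace.inner_def]
  rw [(waveMomentum j Φ).isCore.innerProduct_eq Ψ.isCore
      (Finset.subset_union_left (s₂ := (waveMomentum j Ψ).isCore.finite.toFinset)),
    Φ.isCore.innerProduct_eq (waveMomentum j Ψ).isCore
      (Finset.subset_union_right (s₁ := Ψ.isCore.finite.toFinset))]
  refine Finset.sum_congr rfl fun n _ => ?_
  have hconj : ∀ x, fderiv ℝ (fun y => conj (Φ.1 y n)) x (EuclideanSpace.single j 1) =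
      conj (fderiv ℝ (fun y => Φ.1 y n) x (EuclideanSpace.single j 1)) := by
    intro x
    have h := (Complex.conjCLE : ℂ →L[ℝ] ℂ).hasFDerivAt.comp x
      (Φ.isCore.differentiable n x).hasFDerivAt
    have h2 : fderiv ℝ (fun y => conj (Φ.1 y n)) x =
        (Complex.conjCLE : ℂ →L[ℝ] ℂ).comp (fderiv ℝ (fun y => Φ.1 y n) x) :=
      HasFDerivAt.fderiv h
    rw [h2]
    simp
  have hl : ∀ x, conj ((waveMomentum j Φ).1 x n) =
      Complex.I * fderiv ℝ (fun y => conj (Φ.1 y n)) x (EuclideanSpace.single j 1) := by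
    intro x
    rw [hconj]
    change conj (-Complex.I * _) = _
    simp
  have hr : ∀ x, (waveMomentum j Ψ).1 x n =
      -Complex.I * fderiv ℝ (fun y => Ψ.1 y n) x (EuclideanSpace.single j 1) := fun x => rfl
  have i1 := (waveMomentum j Φ).isCore.integrable_conj_mul Ψ.isCore n
  have i2 := Φ.isCore.integrable_conj_mul (waveMomentum j Ψ).isCore n
  have i3 := Φ.isCore.integrable_conj_mul Ψ.isCore n
  simp only [hl] at i1 ⊢
  simp only [hr] at i2 ⊢
  have key := integral_mul_fderiv_eq_neg_fderiv_mul_of_integrable (μ := (volume : Measure Space))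
    (f := fun y => conj (Φ.1 y n)) (g := fun y => Ψ.1 y n) (v := EuclideanSpace.single j 1)
    (by
      have := i1.const_mul (-Complex.I)
      refine this.congr (Filter.Eventually.of_forall fun x => ?_)
      simp only [← mul_assoc]
      simp)
    (by
      have := i2.const_mul Complex.I
      refine this.congr (Filter.Eventually.of_forall fun x => ?_)
      simp only [mul_left_comm _ (-Complex.I), ← mul_assoc]
      simp) i3
    (fun x _ => (Complex.conjCLE : ℂ →L[ℝ] ℂ).differentiableAt.comp x
      (Φ.isCore.differentiable n x))
    (fun x _ => Ψ.isCore.differentiable n x)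
  simp only [mul_assoc, mul_left_comm _ (-Complex.I), integral_const_mul]
  rw [key]
  ring

end CoreSpace

section Energy

variable {L Λ : ℝ} {hL : 0 < L}

/-! ### Modes -/

theorem waveVector_apply (L : ℝ) (n : Fin 3 → ℤ) (i : Fin 3) :
    waveVector L n i = 2 * Real.pi * (n i : ℝ) / L := rfl

theorem waveVector_ne_zero (hL : 0 < L) {n : Fin 3 → ℤ} (hn : n ≠ 0) : waveVector L n ≠ 0 := by
  obtain ⟨i, hi⟩ := Function.ne_iff.1 hn
  intro h
  have h1 : waveVector L n i = 0 := by rw [h]; rfl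
  rw [waveVector_apply] at h1
  have h2 : (n i : ℝ) ≠ 0 := by exact_mod_cast hi
  have := Real.pi_pos
  have h3 : 2 * Real.pi * (n i : ℝ) / L ≠ 0 := by positivity
  exact h3 h1

theorem mem_cutoffLabels {n : Fin 3 → ℤ} :
    n ∈ cutoffLabels L Λ hL ↔ n ≠ 0 ∧ ‖waveVector L n‖ < Λ := by
  simp [cutoffLabels]

theorem Mode.k_ne_zero (m : Mode L Λ hL) : m.k ≠ 0 :=
  waveVector_ne_zero hL (mem_cutoffLabels.1 m.1.2).1

theorem Mode.norm_k_pos (m : Mode L Λ hL) : 0 < ‖m.k‖ := norm_pos_iff.2 m.k_ne_zero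

theorem Mode.norm_k_lt (m : Mode L Λ hL) : ‖m.k‖ < Λ := (mem_cutoffLabels.1 m.1.2).2

theorem Space.inner_eq (x y : Space) : inner ℝ x y = ∑ j, x j * y j := by
  rw [PiLp.inner_apply]
  exact Finset.sum_congr rfl fun j _ => by simp [mul_comm]

theorem IsPolarization.sum_mul_k {ε : Space → Fin 2 → Space} (hε : IsPolarization ε)
    (m : Mode L Λ hL) : ∑ j, ε m.k m.2 j * m.k j = 0 := by
  rw [← Space.inner_eq]
  exact (hε m.k m.k_ne_zero).2 m.2

theorem IsPolarization.sum_sq {ε : Space → Fin 2 → Space} (hε : IsPolarization ε)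
    (m : Mode L Λ hL) : ∑ j, ε m.k m.2 j ^ 2 = 1 := by
  have h := (hε m.k m.k_ne_zero).1 m.2 m.2
  rw [Space.inner_eq, if_pos rfl] at h
  rw [← h]
  exact Finset.sum_congr rfl fun j _ => by ring

/-- The coupling `1 / √(2 V |k|)` of a mode. -/
def Mode.coupling (m : Mode L Λ hL) : ℝ := 1 / Real.sqrt (2 * L ^ 3) * (1 / Real.sqrt ‖m.k‖)

/-! ### The energy form -/

theorem CoreSpace.sum_val {κ : Type*} (s : Finset κ) (f : κ → CoreSpace L Λ hL) (x : Space)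
    (n : Mode L Λ hL → ℕ) : (∑ i ∈ s, f i).1 x n = ∑ i ∈ s, (f i).1 x n := by
  have h := map_sum (coreSubmodule L Λ hL).subtype f s
  have h2 := congrFun (congrFun h x) n
  refine Eq.trans h2 ?_
  simp only [Finset.sum_apply]
  rfl

/-- The `j`-th component of the vector potential on the core. -/
def wavePotential (ε : Space → Fin 2 → Space) (j : Fin 3) (Ψ : CoreSpace L Λ hL) :
    CoreSpace L Λ hL :=
  ∑ m, ((m.coupling * ε m.k m.2 j : ℝ) : ℂ) • (waveAnn m Ψ + waveCre m Ψ)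

/-- The `j`-th component of `p + √α A(x)` on the core. -/
def waveKinetic (α : ℝ) (ε : Space → Fin 2 → Space) (j : Fin 3) (Ψ : CoreSpace L Λ hL) :
    CoreSpace L Λ hL :=
  waveMomentum j Ψ + (Real.sqrt α : ℂ) • wavePotential ε j Ψ

theorem waveKinetic_val (α : ℝ) (ε : Space → Fin 2 → Space) (j : Fin 3) (Ψ : CoreSpace L Λ hL) :
    (waveKinetic α ε j Ψ).1 = kineticMomentum α ε j Ψ.1 := by
  funext x n
  have h : (wavePotential ε j Ψ).1 x n = vectorPotential ε j Ψ.1 x n := by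
    rw [wavePotential, CoreSpace.sum_val, vectorPotential, Finset.mul_sum]
    refine Finset.sum_congr rfl fun m _ => ?_
    change ((m.coupling * ε m.k m.2 j : ℝ) : ℂ) * (planeWave m x * annihilate m (Ψ.1 x) n +
      conj (planeWave m x) * create m (Ψ.1 x) n) = _
    rw [conj_planeWave, planeWave, ← mul_assoc, ← Complex.ofReal_mul, Mode.coupling, mul_assoc]
  change momentum j Ψ.1 x n + (Real.sqrt α : ℂ) * (wavePotential ε j Ψ).1 x n = _
  rw [h]
  rfl

theorem inner_waveKinetic (α : ℝ) (ε : Space → Fin 2 → Space) (j : Fin 3)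
    (Φ Ψ : CoreSpace L Λ hL) :
    inner ℂ (waveKinetic α ε j Φ) Ψ = inner ℂ Φ (waveKinetic α ε j Ψ) := by
  simp only [waveKinetic, wavePotential, inner_add_left, inner_add_right, inner_smul_left,
    inner_smul_right, sum_inner, inner_sum, Complex.conj_ofReal, inner_waveMomentum,
    wave_isCCR.adj, wave_isCCR.adj', add_comm]

/-- The quadratic form of the Hamiltonian. -/
def energy (α : ℝ) (ε : Space → Fin 2 → Space) (Ψ : CoreSpace L Λ hL) : ℝ :=
  1 / 2 * ∑ j, ‖waveKinetic α ε j Ψ‖ ^ 2 + ∑ m : Mode L Λ hL, ‖m.k‖ * ‖waveAnn m Ψ‖ ^ 2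

/-- All operators preserve the core and `p + √α A` is symmetric there, so one factor can be moved to
the left. The phases of `waveCre` and `waveAnn` cancel in `H_f`. -/
theorem innerProduct_hamiltonian (α : ℝ) (ε : Space → Fin 2 → Space) (Ψ : CoreSpace L Λ hL) :
    (innerProduct Ψ.1 (hamiltonian α ε Ψ.1)).re = energy α ε Ψ := by
  let HΨ : CoreSpace L Λ hL := (1 / 2 : ℂ) • ∑ j, waveKinetic α ε j (waveKinetic α ε j Ψ) +
    ∑ m : Mode L Λ hL, (‖m.k‖ : ℂ) • waveCre m (waveAnn m Ψ)
  have hH : HΨ.1 = hamiltonian α ε Ψ.1 := by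
    funext x n
    change (1 / 2 : ℂ) * (∑ j, waveKinetic α ε j (waveKinetic α ε j Ψ)).1 x n +
      (∑ m : Mode L Λ hL, (‖m.k‖ : ℂ) • waveCre m (waveAnn m Ψ)).1 x n = _
    rw [CoreSpace.sum_val, CoreSpace.sum_val, hamiltonian, fieldEnergy]
    refine congrArg₂ (· + ·) (congrArg _ (Finset.sum_congr rfl fun j _ => ?_))
      (Finset.sum_congr rfl fun m _ => ?_)
    · rw [waveKinetic_val, waveKinetic_val]
    · change (‖m.k‖ : ℂ) *
        (conj (planeWave m x) * create m (planeWave m x • annihilate m (Ψ.1 x)) n) = _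
      rw [create_smul, Pi.smul_apply, smul_eq_mul, ← mul_assoc (conj _), conj_planeWave_mul,
        one_mul]
  rw [← hH, ← CoreSpace.inner_def]
  have h : (inner ℂ Ψ HΨ : ℂ) = ((energy α ε Ψ : ℝ) : ℂ) := by
    simp only [HΨ, inner_add_right, inner_smul_right, inner_sum, ← inner_waveKinetic,
      ← wave_isCCR.adj', inner_self_eq_norm_sq_to_K, energy]
    push_cast
    rfl
  rw [h, Complex.ofReal_re]

theorem innerProduct_self_re (Ψ : CoreSpace L Λ hL) : (innerProduct Ψ.1 Ψ.1).re = ‖Ψ‖ ^ 2 := by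
  rw [← CoreSpace.inner_def]
  exact (norm_sq_eq_re_inner (𝕜 := ℂ) Ψ).symm

/-- The choice `d = t √|k|` cancels the `1/√|k|` of the coupling, so every mode contributes equally
to the main term, which becomes `√(M / L³)` up to a constant. -/
theorem energy_lower_bound (α : ℝ) {ε : Space → Fin 2 → Space}
    (hε : IsPolarization ε) (hM : 0 < Fintype.card (Mode L Λ hL)) (Ψ : CoreSpace L Λ hL) :
    (1 / 2 * (Real.sqrt α * Real.sqrt (Fintype.card (Mode L Λ hL) / L ^ 3)) - Λ / 2) * ‖Ψ‖ ^ 2 ≤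
      energy α ε Ψ := by
  set M : ℝ := (Fintype.card (Mode L Λ hL) : ℝ) with hMdef
  have hM' : 0 < M := by rw [hMdef]; exact_mod_cast hM
  -- Normalized so that `∑ d²/|k| = 1/2`: after halving the inequality, the cost of `Y²` is exactly
  -- one copy of `H_f`.
  let t : ℝ := 1 / Real.sqrt (2 * M)
  have ht : t ^ 2 * M = 1 / 2 := by
    simp only [t, div_pow, one_pow]
    rw [Real.sq_sqrt (by positivity)]
    field_simp
  have h := kinetic_lower_bound wave_isCCR waveMomentum inner_waveMomentum
    (fun m : Mode L Λ hL => fun j => m.k j) (fun m => fun j => ε m.k m.2 j) Mode.coupling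
    (fun m => t * Real.sqrt ‖m.k‖) (fun m => ‖m.k‖) (Real.sqrt α) (fun m => m.norm_k_pos)
    waveMomentum_waveAnn waveMomentum_waveCre hε.sum_mul_k hε.sum_sq Ψ
  have h1 : ∑ m : Mode L Λ hL, (t * Real.sqrt ‖m.k‖) ^ 2 / ‖m.k‖ = 1 / 2 := by
    rw [← ht, hMdef, Finset.sum_congr rfl (g := fun _ => t ^ 2)]
    · simp [mul_comm]
    · intro m _
      have := m.norm_k_pos
      rw [mul_pow, Real.sq_sqrt this.le]
      field_simp
  have h2 : ∑ m : Mode L Λ hL, (t * Real.sqrt ‖m.k‖) ^ 2 ≤ Λ / 2 := by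
    have : Λ / 2 = ∑ _m : Mode L Λ hL, t ^ 2 * Λ := by
      rw [Finset.sum_const, Finset.card_univ, nsmul_eq_mul, ← hMdef]
      linear_combination (-Λ) * ht
    rw [this]
    refine Finset.sum_le_sum fun m _ => ?_
    rw [mul_pow, Real.sq_sqrt m.norm_k_pos.le]
    exact mul_le_mul_of_nonneg_left m.norm_k_lt.le (by positivity)
  have h3 : ∑ m : Mode L Λ hL, m.coupling * (t * Real.sqrt ‖m.k‖) =
      1 / 2 * Real.sqrt (M / L ^ 3) := by
    have h4 : ∀ m : Mode L Λ hL, m.coupling * (t * Real.sqrt ‖m.k‖) =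
        t / Real.sqrt (2 * L ^ 3) := by
      intro m
      have := Real.sqrt_pos.2 m.norm_k_pos
      unfold Mode.coupling
      field_simp
    rw [Finset.sum_congr rfl fun m _ => h4 m, Finset.sum_const, Finset.card_univ, nsmul_eq_mul,
      ← hMdef]
    simp only [t]
    rw [Real.sqrt_div hM'.le, Real.sqrt_mul (by norm_num), Real.sqrt_mul (by norm_num)]
    have hs2 : Real.sqrt 2 ^ 2 = 2 := Real.sq_sqrt (by norm_num)
    have hsM : Real.sqrt M ^ 2 = M := Real.sq_sqrt hM'.le
    have p1 : 0 < Real.sqrt 2 := by positivity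
    have p2 : 0 < Real.sqrt M := by positivity
    have p3 : 0 < Real.sqrt (L ^ 3) := by positivity
    field_simp
    rw [hs2, hsM, mul_comm]
  rw [h1, h3] at h
  have h5 : ∑ j, ‖waveMomentum j Ψ + (Real.sqrt α : ℂ) •
      ∑ m : Mode L Λ hL, ((m.coupling * ε m.k m.2 j : ℝ) : ℂ) • (waveAnn m Ψ + waveCre m Ψ)‖ ^ 2 =
      ∑ j, ‖waveKinetic α ε j Ψ‖ ^ 2 := rfl
  rw [h5] at h
  unfold energy
  have h6 := mul_le_mul_of_nonneg_right h2 (sq_nonneg ‖Ψ‖)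
  linarith

end Energy

/-! ### Counting wave vectors below the cutoff -/

section Lattice

variable {L Λ : ℝ} {hL : 0 < L}

/-- The lattice points of the cube of half side `q`. -/
def latticeCube (q : ℕ) : Finset (Fin 3 → ℤ) :=
  Fintype.piFinset fun _ => Finset.Icc (-(q : ℤ)) q

theorem mem_latticeCube {q : ℕ} {n : Fin 3 → ℤ} : n ∈ latticeCube q ↔ ∀ i, |n i| ≤ q := by
  simp [latticeCube, abs_le]

theorem card_latticeCube (q : ℕ) : (latticeCube q).card = (2 * q + 1) ^ 3 := by
  simp only [latticeCube, Fintype.card_piFinset, Int.card_Icc, Finset.prod_const,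
    Finset.card_univ, Fintype.card_fin]
  congr 1
  omega

theorem card_mode : Fintype.card (Mode L Λ hL) = 2 * (cutoffLabels L Λ hL).card := by
  simp [mul_comm]

theorem card_mode_ge (h : 8 * Real.pi ≤ L * Λ) :
    (L * Λ) ^ 3 / 1600 ≤ (Fintype.card (Mode L Λ hL) : ℝ) := by
  have hpi := Real.pi_pos
  have hpi3 := Real.pi_gt_three
  have hpi4 := Real.pi_lt_d2
  -- The cube of half side `q` lies in the cutoff ball since its corners have `|k| ≤ √3 Λ/2`. The
  -- assumption `LΛ ≥ 8π` limits the loss in the floor to a factor 2.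
  set q : ℕ := ⌊L * Λ / (4 * Real.pi)⌋₊ with hq
  have hq1 : (q : ℝ) ≤ L * Λ / (4 * Real.pi) := Nat.floor_le (by
    apply div_nonneg _ (by positivity)
    linarith [mul_pos (show (0 : ℝ) < 8 by norm_num) hpi])
  have hq2 : L * Λ / (4 * Real.pi) < q + 1 := Nat.lt_floor_add_one _
  have hq3 : L * Λ / (8 * Real.pi) ≤ q := by
    have : 1 ≤ L * Λ / (8 * Real.pi) := by rw [le_div_iff₀ (by positivity)]; linarith
    have h2 : L * Λ / (4 * Real.pi) = 2 * (L * Λ / (8 * Real.pi)) := by field_simp; ring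
    linarith
  have hq4 : (1 : ℝ) ≤ q := by
    have : 1 ≤ L * Λ / (8 * Real.pi) := by rw [le_div_iff₀ (by positivity)]; linarith
    linarith
  have hsub : (latticeCube q).erase 0 ⊆ cutoffLabels L Λ hL := by
    intro n hn
    obtain ⟨hn0, hn⟩ := Finset.mem_erase.1 hn
    rw [mem_latticeCube] at hn
    refine mem_cutoffLabels.2 ⟨hn0, ?_⟩
    have h1 : ∀ i, (waveVector L n i) ^ 2 ≤ (2 * Real.pi * q / L) ^ 2 := by
      intro i
      rw [waveVector_apply, div_pow, div_pow]
      refine div_le_div_of_nonneg_right ?_ (by positivity)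
      rw [mul_pow, mul_pow _ (q : ℝ)]
      refine mul_le_mul_of_nonneg_left ?_ (by positivity)
      have : |(n i : ℝ)| ≤ q := by exact_mod_cast hn i
      rw [← sq_abs]
      exact pow_le_pow_left₀ (abs_nonneg _) this 2
    have h2 : ‖waveVector L n‖ ^ 2 ≤ 3 * (2 * Real.pi * q / L) ^ 2 := by
      rw [EuclideanSpace.norm_sq_eq]
      simp only [Real.norm_eq_abs, sq_abs]
      refine (Finset.sum_le_sum fun i _ => h1 i).trans (le_of_eq ?_)
      simp
    have h3 : 2 * (2 * Real.pi * q / L) ≤ Λ := by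
      rw [le_div_iff₀ (by positivity)] at hq1
      rw [mul_div_assoc', div_le_iff₀ hL]
      linarith
    have h4 : 0 < 2 * Real.pi * q / L := by positivity
    have h5 : ‖waveVector L n‖ ^ 2 < Λ ^ 2 := by nlinarith
    exact lt_of_pow_lt_pow_left₀ 2 (by linarith) h5
  have hcard := Finset.card_le_card hsub
  rw [Finset.card_erase_of_mem (mem_latticeCube.2 fun i => by simp), card_latticeCube] at hcard
  have h6 : 8 * q ^ 3 ≤ (cutoffLabels L Λ hL).card := by
    refine le_trans ?_ hcard
    have : (2 * q + 1) ^ 3 = 8 * q ^ 3 + 12 * q ^ 2 + 6 * q + 1 := by ring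
    omega
  have h7 : (16 : ℝ) * q ^ 3 ≤ (Fintype.card (Mode L Λ hL) : ℝ) := by
    rw [card_mode]
    have : (8 : ℝ) * q ^ 3 ≤ (cutoffLabels L Λ hL).card := by exact_mod_cast h6
    push_cast
    linarith
  refine le_trans ?_ h7
  have h8 : (L * Λ / (8 * Real.pi)) ^ 3 ≤ (q : ℝ) ^ 3 :=
    pow_le_pow_left₀ (div_nonneg (by linarith [mul_pos (show (0 : ℝ) < 8 by norm_num) hpi])
      (by positivity)) hq3 3
  have h9 : (8 * Real.pi) ^ 3 ≤ 25600 := by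
    have : (8 * Real.pi) ^ 3 ≤ (8 * 3.15) ^ 3 := pow_le_pow_left₀ (by positivity) (by linarith) 3
    norm_num at this ⊢
    linarith
  have h10 : (L * Λ) ^ 3 / 25600 ≤ (L * Λ / (8 * Real.pi)) ^ 3 := by
    rw [div_pow]
    refine div_le_div_of_nonneg_left ?_ (by positivity) h9
    have : 0 < L * Λ := by linarith [mul_pos (show (0 : ℝ) < 8 by norm_num) hpi]
    positivity
  linarith

/-- The maximum norm of a lattice point. -/
def maxAbs (n : Fin 3 → ℤ) : ℕ := Finset.univ.sup fun i => (n i).natAbs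

theorem maxAbs_le {n : Fin 3 → ℤ} {q : ℕ} : maxAbs n ≤ q ↔ n ∈ latticeCube q := by
  rw [mem_latticeCube, maxAbs, Finset.sup_le_iff]
  constructor
  · intro h i
    have := h i (Finset.mem_univ i)
    rw [Int.abs_eq_natAbs]
    exact_mod_cast this
  · intro h i _
    have := h i
    rw [Int.abs_eq_natAbs] at this
    exact_mod_cast this

/-- A full shell has `(2q + 1)³ - (2q - 1)³ = 24q² + 2` points. -/
theorem card_maxAbs_eq_le (S : Finset (Fin 3 → ℤ)) {q : ℕ} (hq : 0 < q) :
    (S.filter fun n => maxAbs n = q).card ≤ 26 * q ^ 2 := by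
  have hsub : (S.filter fun n => maxAbs n = q) ⊆ latticeCube q \ latticeCube (q - 1) := by
    intro n hn
    have h := (Finset.mem_filter.1 hn).2
    rw [Finset.mem_sdiff, ← maxAbs_le, ← maxAbs_le]
    omega
  refine (Finset.card_le_card hsub).trans ?_
  have hs : latticeCube (q - 1) ⊆ latticeCube q := by
    intro n hn
    rw [← maxAbs_le] at hn ⊢
    omega
  rw [Finset.card_sdiff_of_subset hs, card_latticeCube, card_latticeCube]
  obtain ⟨p, rfl⟩ : ∃ p, q = p + 1 := ⟨q - 1, by omega⟩
  simp only [Nat.add_sub_cancel]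
  rw [Nat.sub_le_iff_le_add]
  nlinarith

theorem maxAbs_le_norm (hL : 0 < L) (n : Fin 3 → ℤ) :
    2 * Real.pi * maxAbs n / L ≤ ‖waveVector L n‖ := by
  obtain ⟨i, -, hi⟩ := Finset.exists_mem_eq_sup Finset.univ Finset.univ_nonempty
    fun i => (n i).natAbs
  have h1 : |2 * Real.pi * (n i : ℝ) / L| ≤ ‖waveVector L n‖ := PiLp.norm_apply_le (waveVector L n) i
  refine le_trans (le_of_eq ?_) h1
  have h2 : ((maxAbs n : ℕ) : ℝ) = |(n i : ℝ)| := by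
    rw [maxAbs, hi, Nat.cast_natAbs, Int.cast_abs]
  rw [h2, abs_div, abs_of_pos hL, abs_mul, abs_of_pos (by positivity : (0 : ℝ) < 2 * Real.pi)]

/-- This is the vacuum expectation of `A(x)²`. Summing over shells of the maximum norm, `1/|k| ≤
L/(2πq)` against at most `26q²` points gives a bound valid for every `L`; no largeness of the box is
needed because the zero mode is excluded. -/
theorem sum_coupling_sq_le (hΛ : 0 < Λ) : ∑ m : Mode L Λ hL, m.coupling ^ 2 ≤ Λ ^ 2 := by
  have hpi := Real.pi_pos
  have hpi3 := Real.pi_gt_three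
  set R : ℕ := ⌊Λ * L / (2 * Real.pi)⌋₊ with hR
  have hRle : (R : ℝ) ≤ Λ * L / (2 * Real.pi) := Nat.floor_le (by positivity)
  have hpos : ∀ n ∈ cutoffLabels L Λ hL, 0 < maxAbs n := by
    intro n hn
    by_contra h0
    apply (mem_cutoffLabels.1 hn).1
    have h1 : maxAbs n ≤ 0 := by omega
    rw [maxAbs_le, mem_latticeCube] at h1
    funext i
    simpa using h1 i
  have hmaps : ∀ n ∈ cutoffLabels L Λ hL, maxAbs n ∈ Finset.Icc 1 R := by
    intro n hn
    refine Finset.mem_Icc.2 ⟨hpos n hn, Nat.le_floor ?_⟩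
    have h1 := (maxAbs_le_norm hL n).trans (mem_cutoffLabels.1 hn).2.le
    rw [div_le_iff₀ hL] at h1
    rw [le_div_iff₀ (by positivity)]
    linarith
  have h1 : ∑ n ∈ cutoffLabels L Λ hL, 1 / ‖waveVector L n‖ ≤
      26 * L / (2 * Real.pi) * (Λ * L / (2 * Real.pi)) ^ 2 := by
    rw [← Finset.sum_fiberwise_of_maps_to hmaps]
    calc ∑ q ∈ Finset.Icc 1 R, ∑ n ∈ cutoffLabels L Λ hL with maxAbs n = q, 1 / ‖waveVector L n‖
        ≤ ∑ q ∈ Finset.Icc 1 R, 26 * L / (2 * Real.pi) * (R : ℝ) := by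
          refine Finset.sum_le_sum fun q hq => ?_
          have hq0 : 0 < q := (Finset.mem_Icc.1 hq).1
          have hq0' : (0 : ℝ) < q := by exact_mod_cast hq0
          have hqR : (q : ℝ) ≤ R := by exact_mod_cast (Finset.mem_Icc.1 hq).2
          have h2 : ∀ n ∈ (cutoffLabels L Λ hL).filter (fun n => maxAbs n = q),
              1 / ‖waveVector L n‖ ≤ L / (2 * Real.pi * q) := by
            intro n hn
            have h3 := maxAbs_le_norm hL n
            rw [(Finset.mem_filter.1 hn).2] at h3
            have h4 : (0 : ℝ) < 2 * Real.pi * q / L := by positivity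
            refine (one_div_le_one_div_of_le h4 h3).trans (le_of_eq ?_)
            rw [one_div_div]
          refine (Finset.sum_le_card_nsmul _ _ _ h2).trans ?_
          rw [nsmul_eq_mul]
          have h5 : (((cutoffLabels L Λ hL).filter (fun n => maxAbs n = q)).card : ℝ) ≤
              26 * q ^ 2 := by exact_mod_cast card_maxAbs_eq_le _ hq0
          refine (mul_le_mul_of_nonneg_right h5 (by positivity)).trans ?_
          have h6 : 26 * (q : ℝ) ^ 2 * (L / (2 * Real.pi * q)) = 26 * L / (2 * Real.pi) * q := by
            field_simp
          rw [h6]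
          exact mul_le_mul_of_nonneg_left hqR (by positivity)
      _ = 26 * L / (2 * Real.pi) * (R : ℝ) ^ 2 := by
          rw [Finset.sum_const, Nat.card_Icc, nsmul_eq_mul, Nat.add_sub_cancel]; ring
      _ ≤ _ := mul_le_mul_of_nonneg_left (pow_le_pow_left₀ (by positivity) hRle 2) (by positivity)
  have h2 : ∀ m : Mode L Λ hL, m.coupling ^ 2 = 1 / (2 * L ^ 3) * (1 / ‖waveVector L m.1.1‖) := by
    intro m
    rw [Mode.coupling, mul_pow, div_pow, div_pow, Real.sq_sqrt (by positivity),
      Real.sq_sqrt (norm_nonneg _), one_pow]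
    rfl
  have h3 : ∑ m : Mode L Λ hL, m.coupling ^ 2 =
      1 / L ^ 3 * ∑ n ∈ cutoffLabels L Λ hL, 1 / ‖waveVector L n‖ := by
    rw [Finset.sum_congr rfl fun m _ => h2 m, ← Finset.mul_sum, Fintype.sum_prod_type]
    simp only [Finset.sum_const, Finset.card_univ, Fintype.card_fin]
    rw [← Finset.smul_sum, Finset.sum_coe_sort (cutoffLabels L Λ hL)
      (fun n => 1 / ‖waveVector L n‖), nsmul_eq_mul]
    push_cast
    field_simp
  rw [h3]
  refine (mul_le_mul_of_nonneg_left h1 (by positivity)).trans ?_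
  have h4 : 1 / L ^ 3 * (26 * L / (2 * Real.pi) * (Λ * L / (2 * Real.pi)) ^ 2) =
      Λ ^ 2 * (26 / (2 * Real.pi) ^ 3) := by
    field_simp
  rw [h4]
  refine mul_le_of_le_one_right (by positivity) ?_
  rw [div_le_one (by positivity)]
  have : (6 : ℝ) ^ 3 ≤ (2 * Real.pi) ^ 3 := pow_le_pow_left₀ (by norm_num) (by linarith) 3
  linarith

end Lattice

/-! ### Product trial states -/

section Trial

variable {L Λ : ℝ} {hL : 0 < L}

/-- The product of an electron wave function and a Fock vector. -/
def tensor (φ : Space → ℝ) (hφ : ContDiff ℝ ∞ φ) (hc : HasCompactSupport φ)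
    (Θ : FockSpace (Mode L Λ hL)) : CoreSpace L Λ hL :=
  ⟨fun x n => (φ x : ℂ) * Θ.1 n,
    { smooth := fun n => (Complex.ofRealCLM.contDiff.comp hφ).mul contDiff_const
      compact := fun n => (hc.comp_left (g := fun t : ℝ => (t : ℂ)) (by simp)).mul_right
      finite := by
        refine Θ.2.subset ?_
        rintro n ⟨x, hx⟩
        exact right_ne_zero_of_mul hx }⟩

/-- The value of a wave function at a position of the electron. -/
def CoreSpace.eval (Ψ : CoreSpace L Λ hL) (x : Space) : FockSpace (Mode L Λ hL) :=
  ⟨Ψ.1 x, Ψ.isCore.finite.subset fun _ hn => ⟨x, hn⟩⟩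

theorem CoreSpace.norm_sq_eq (Ψ : CoreSpace L Λ hL) : ‖Ψ‖ ^ 2 = ∫ x, ‖Ψ.eval x‖ ^ 2 := by
  rw [← innerProduct_self_re, innerProduct_self, Complex.ofReal_re]
  congr 1
  funext x
  exact (FockSpace.norm_sq (Ψ.eval x)).symm

theorem norm_tensor_sq (φ : Space → ℝ) (hφ : ContDiff ℝ ∞ φ) (hc : HasCompactSupport φ)
    (Θ : FockSpace (Mode L Λ hL)) : ‖tensor φ hφ hc Θ‖ ^ 2 = (∫ x, φ x ^ 2) * ‖Θ‖ ^ 2 := by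
  rw [CoreSpace.norm_sq_eq, ← integral_mul_const]
  congr 1
  funext x
  have h : (tensor φ hφ hc Θ).eval x = (φ x : ℂ) • Θ := rfl
  rw [h, norm_smul, mul_pow, Complex.norm_real, Real.norm_eq_abs, sq_abs]

theorem norm_waveAnn_tensor_sq (φ : Space → ℝ) (hφ : ContDiff ℝ ∞ φ) (hc : HasCompactSupport φ)
    (Θ : FockSpace (Mode L Λ hL)) (m : Mode L Λ hL) :
    ‖waveAnn m (tensor φ hφ hc Θ)‖ ^ 2 = (∫ x, φ x ^ 2) * ‖fockAnn m Θ‖ ^ 2 := by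
  rw [CoreSpace.norm_sq_eq, ← integral_mul_const]
  congr 1
  funext x
  have h : (waveAnn m (tensor φ hφ hc Θ)).eval x = (planeWave m x * φ x) • fockAnn m Θ := by
    apply Subtype.ext
    funext n
    change planeWave m x * annihilate m ((φ x : ℂ) • Θ.1) n =
      (planeWave m x * φ x) * annihilate m Θ.1 n
    rw [annihilate_smul, Pi.smul_apply, smul_eq_mul, mul_assoc]
  have h1 : ‖planeWave m x‖ = 1 := by
    rw [planeWave, mul_comm, Complex.norm_exp_ofReal_mul_I]
  rw [h, norm_smul, norm_mul, h1, one_mul, mul_pow, Complex.norm_real, Real.norm_eq_abs, sq_abs]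

/-- The one-particle vector of the `j`-th component of the vector potential at `x`. -/
def potentialVector (ε : Space → Fin 2 → Space) (j : Fin 3) (x : Space) :
    EuclideanSpace ℂ (Mode L Λ hL) :=
  WithLp.toLp 2 fun m => ((m.coupling * ε m.k m.2 j : ℝ) : ℂ) * conj (planeWave m x)

theorem FockSpace.sum_val {κ : Type*} {ι : Type} (s : Finset κ) (f : κ → FockSpace ι)
    (n : ι → ℕ) : (∑ i ∈ s, f i).1 n = ∑ i ∈ s, (f i).1 n := by
  have h := map_sum (finiteParticle ι).subtype f s
  have h2 := congrFun h n
  refine Eq.trans h2 ?_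
  simp only [Finset.sum_apply]
  rfl

theorem wavePotential_tensor_eval (φ : Space → ℝ) (hφ : ContDiff ℝ ∞ φ)
    (hc : HasCompactSupport φ) (Θ : FockSpace (Mode L Λ hL)) (ε : Space → Fin 2 → Space)
    (j : Fin 3) (x : Space) :
    (wavePotential ε j (tensor φ hφ hc Θ)).eval x = (φ x : ℂ) •
      (ann fockAnn (potentialVector ε j x) Θ + cre fockCre (potentialVector ε j x) Θ) := by
  rw [ann_apply, cre_apply, ← Finset.sum_add_distrib, Finset.smul_sum]
  apply Subtype.ext
  funext n
  change (wavePotential ε j (tensor φ hφ hc Θ)).1 x n = _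
  rw [wavePotential, CoreSpace.sum_val, FockSpace.sum_val]
  refine Finset.sum_congr rfl fun m _ => ?_
  change ((m.coupling * ε m.k m.2 j : ℝ) : ℂ) * (planeWave m x * annihilate m ((φ x : ℂ) • Θ.1) n +
      conj (planeWave m x) * create m ((φ x : ℂ) • Θ.1) n) =
    (φ x : ℂ) * (conj (((m.coupling * ε m.k m.2 j : ℝ) : ℂ) * conj (planeWave m x)) *
      annihilate m Θ.1 n + ((m.coupling * ε m.k m.2 j : ℝ) : ℂ) * conj (planeWave m x) *
      create m Θ.1 n)
  rw [annihilate_smul, create_smul, Pi.smul_apply, Pi.smul_apply, smul_eq_mul, smul_eq_mul,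
    map_mul, Complex.conj_conj, Complex.conj_ofReal]
  ring

theorem waveMomentum_tensor_eval (φ : Space → ℝ) (hφ : ContDiff ℝ ∞ φ)
    (hc : HasCompactSupport φ) (Θ : FockSpace (Mode L Λ hL)) (j : Fin 3) (x : Space) :
    (waveMomentum j (tensor φ hφ hc Θ)).eval x =
      (-Complex.I * (fderiv ℝ φ x (EuclideanSpace.single j 1) : ℝ)) • Θ := by
  apply Subtype.ext
  funext n
  change -Complex.I * fderiv ℝ (fun y => (φ y : ℂ) * Θ.1 n) x _ = _ * Θ.1 n
  have h1 : HasFDerivAt φ (fderiv ℝ φ x) x :=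
    ((hφ.differentiable (by simp)) x).hasFDerivAt
  have h2 : HasFDerivAt (fun y => (φ y : ℂ)) (Complex.ofRealCLM.comp (fderiv ℝ φ x)) x :=
    Complex.ofRealCLM.hasFDerivAt.comp x h1
  have h3 := h2.mul_const (Θ.1 n)
  rw [h3.fderiv]
  simp only [_root_.smul_apply, ContinuousLinearMap.comp_apply, Complex.ofRealCLM_apply,
    smul_eq_mul]
  ring

/-- For real `φ` the cross term vanishes: the momentum carries a factor `-i`, while `φ`, its
derivative and the expectation of the symmetric field operator are real. -/
theorem norm_waveKinetic_tensor_eval_sq {α : ℝ} (hα : 0 < α) (φ : Space → ℝ)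
    (hφ : ContDiff ℝ ∞ φ)
    (hc : HasCompactSupport φ) (Θ : FockSpace (Mode L Λ hL)) (ε : Space → Fin 2 → Space)
    (j : Fin 3) (x : Space) :
    ‖(waveKinetic α ε j (tensor φ hφ hc Θ)).eval x‖ ^ 2 =
      (fderiv ℝ φ x (EuclideanSpace.single j 1)) ^ 2 * ‖Θ‖ ^ 2 + α * φ x ^ 2 *
        ‖ann fockAnn (potentialVector ε j x) Θ + cre fockCre (potentialVector ε j x) Θ‖ ^ 2 := by
  have h : (waveKinetic α ε j (tensor φ hφ hc Θ)).eval x =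
      (waveMomentum j (tensor φ hφ hc Θ)).eval x +
        (Real.sqrt α : ℂ) • (wavePotential ε j (tensor φ hφ hc Θ)).eval x := rfl
  set X := ann fockAnn (potentialVector ε j x) Θ + cre fockCre (potentialVector ε j x) Θ with hX
  have hreal : (inner ℂ Θ X : ℂ).im = 0 := by
    rw [hX, inner_add_right, ← fock_isCCR.inner_cre,
      ← inner_conj_symm Θ (cre fockCre (potentialVector ε j x) Θ)]
    simp only [Complex.add_im, Complex.conj_im, add_neg_cancel]
  rw [h, waveMomentum_tensor_eval, wavePotential_tensor_eval, ← hX, smul_smul,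
    @norm_add_sq ℂ, inner_smul_left, inner_smul_right, norm_smul, norm_smul]
  have h2 : RCLike.re (conj (-Complex.I * ((fderiv ℝ φ x (EuclideanSpace.single j 1) : ℝ) : ℂ)) *
      ((Real.sqrt α : ℂ) * (φ x : ℂ) * inner ℂ Θ X)) = 0 := by
    simp [hreal]
  rw [h2]
  simp only [norm_mul, norm_neg, Complex.norm_I, Complex.norm_real, Real.norm_eq_abs, mul_pow,
    sq_abs, Real.sq_sqrt hα.le]
  ring

/-- The field fluctuation matters only on the support of `φ`, and each photon costs at most `Λ`. -/
theorem energy_tensor_le (hΛ : 0 ≤ Λ) {α : ℝ} (hα : 0 < α) (φ : Space → ℝ) (hφ : ContDiff ℝ ∞ φ)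
    (hc : HasCompactSupport φ) (Θ : FockSpace (Mode L Λ hL)) (ε : Space → Fin 2 → Space)
    {B : ℝ} (hB : ∀ x, φ x ≠ 0 → ∑ j, ‖ann fockAnn (potentialVector ε j x) Θ +
      cre fockCre (potentialVector ε j x) Θ‖ ^ 2 ≤ B * ‖Θ‖ ^ 2)
    {d : ℕ} (hd : Θ ∈ atMost d) :
    energy α ε (tensor φ hφ hc Θ) ≤
      (1 / 2 * ∑ j, (∫ x, (fderiv ℝ φ x (EuclideanSpace.single j 1)) ^ 2) +
        (α / 2 * B + Λ * d) * ∫ x, φ x ^ 2) * ‖Θ‖ ^ 2 := by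
  set Ψ := tensor φ hφ hc Θ
  have hi0 : ∀ j, Integrable fun x => ‖(waveKinetic α ε j Ψ).eval x‖ ^ 2 := by
    intro j
    have h := ((waveKinetic α ε j Ψ).isCore.integrable_tsum (waveKinetic α ε j Ψ).isCore)
    refine h.re.congr (Filter.Eventually.of_forall fun x => ?_)
    have h2 := FockSpace.norm_sq ((waveKinetic α ε j Ψ).eval x)
    change RCLike.re (∑' n, conj ((waveKinetic α ε j Ψ).1 x n) * (waveKinetic α ε j Ψ).1 x n) = _
    rw [tsum_conj_mul_self, RCLike.re_to_complex, Complex.ofReal_re]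
    exact h2.symm
  have hi1 : ∀ j : Fin 3, Integrable fun x => (fderiv ℝ φ x (EuclideanSpace.single j 1)) ^ 2 := by
    intro j
    have hcont : Continuous fun x => fderiv ℝ φ x (EuclideanSpace.single j 1) :=
      (hφ.continuous_fderiv (by simp)).clm_apply continuous_const
    have hcs : HasCompactSupport fun x => fderiv ℝ φ x (EuclideanSpace.single j 1) :=
      hc.fderiv_apply (𝕜 := ℝ) _
    simp only [sq]
    exact (hcont.mul hcont).integrable_of_hasCompactSupport hcs.mul_left
  have hi2 : Integrable fun x => φ x ^ 2 := by
    simp only [sq]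
    exact (hφ.continuous.mul hφ.continuous).integrable_of_hasCompactSupport hc.mul_left
  have h1 : ∑ j, ‖waveKinetic α ε j Ψ‖ ^ 2 ≤
      (∑ j, (∫ x, (fderiv ℝ φ x (EuclideanSpace.single j 1)) ^ 2) + α * B * ∫ x, φ x ^ 2) *
        ‖Θ‖ ^ 2 := by
    simp only [CoreSpace.norm_sq_eq]
    rw [← integral_finsetSum _ fun j _ => hi0 j, ← integral_finsetSum _ fun j _ => hi1 j,
      ← integral_const_mul, ← integral_add (integrable_finsetSum _ fun j _ => hi1 j)
        (hi2.const_mul _), ← integral_mul_const]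
    refine integral_mono (integrable_finsetSum _ fun j _ => hi0 j)
      (((integrable_finsetSum _ fun j _ => hi1 j).add (hi2.const_mul _)).mul_const _) fun x => ?_
    simp only [Ψ, norm_waveKinetic_tensor_eval_sq hα]
    rw [Finset.sum_add_distrib, ← Finset.sum_mul, ← Finset.mul_sum, add_mul]
    refine add_le_add le_rfl ?_
    by_cases h0 : φ x = 0
    · simp [h0]
    · have h3 := mul_le_mul_of_nonneg_left (hB x h0) (show 0 ≤ α * φ x ^ 2 by positivity)
      linarith
  have h2 : ∑ m : Mode L Λ hL, ‖m.k‖ * ‖waveAnn m Ψ‖ ^ 2 ≤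
      (Λ * d * ∫ x, φ x ^ 2) * ‖Θ‖ ^ 2 := by
    have hnn : 0 ≤ ∫ x, φ x ^ 2 := integral_nonneg fun x => by positivity
    calc ∑ m : Mode L Λ hL, ‖m.k‖ * ‖waveAnn m Ψ‖ ^ 2
        ≤ ∑ m : Mode L Λ hL, Λ * ((∫ x, φ x ^ 2) * ‖fockAnn m Θ‖ ^ 2) := by
          refine Finset.sum_le_sum fun m _ => ?_
          rw [norm_waveAnn_tensor_sq]
          exact mul_le_mul_of_nonneg_right m.norm_k_lt.le (by positivity)
      _ = Λ * (∫ x, φ x ^ 2) * ∑ m : Mode L Λ hL, ‖fockAnn m Θ‖ ^ 2 := by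
          rw [Finset.mul_sum]
          exact Finset.sum_congr rfl fun m _ => by ring
      _ ≤ Λ * (∫ x, φ x ^ 2) * (d * ‖Θ‖ ^ 2) :=
          mul_le_mul_of_nonneg_left (sum_norm_fockAnn_sq_le d Θ hd) (by positivity)
      _ = _ := by ring
  unfold energy
  linarith

end Trial

/-! ### Orthonormal families in a real form of a complex inner product space -/

section RealForm

variable {E : Type*} [NormedAddCommGroup E] [InnerProductSpace ℂ E]

/-- On the real span of `v` the complex inner product takes real values, so a basis orthonormal for
the real inner product is orthonormal over `ℂ` too. Being real combinations of the `v i`, its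
vectors inherit real pairings with `f`. -/
theorem exists_orthonormal_of_real {κ : Type*} [Fintype κ] (v : κ → E)
    (hv : ∀ i j, (inner ℂ (v i) (v j) : ℂ).im = 0) :
    ∃ M : ℕ, M ≤ Fintype.card κ ∧ ∃ g : Fin M → E, Orthonormal ℂ g ∧
      (∀ f, (∀ i, (inner ℂ (v i) f : ℂ).im = 0) → ∀ l, (inner ℂ (g l) f : ℂ).im = 0) ∧
      ∀ i, v i ∈ Submodule.span ℂ (Set.range g) := by
  let _ : InnerProductSpace ℝ E := InnerProductSpace.rclikeToReal ℂ E
  let W : Submodule ℝ E := Submodule.span ℝ (Set.range v)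
  have hfin : FiniteDimensional ℝ W := FiniteDimensional.span_of_finite ℝ (Set.finite_range v)
  let b := stdOrthonormalBasis ℝ W
  have hpair : ∀ f, (∀ i, (inner ℂ (v i) f : ℂ).im = 0) → ∀ w ∈ W, (inner ℂ w f : ℂ).im = 0 := by
    intro f hf w hw
    induction hw using Submodule.span_induction with
    | mem x hx =>
      obtain ⟨i, rfl⟩ := hx
      exact hf i
    | zero => simp
    | add x y _ _ hx hy => rw [inner_add_left, Complex.add_im, hx, hy, add_zero]
    | smul r x _ hx =>
      rw [← Complex.coe_smul, inner_smul_left, Complex.conj_ofReal, Complex.im_ofReal_mul, hx,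
        mul_zero]
  have hWW : ∀ w ∈ W, ∀ w' ∈ W, (inner ℂ w w' : ℂ).im = 0 := by
    intro w hw w' hw'
    refine hpair w' (fun i => ?_) w hw
    rw [← inner_conj_symm, Complex.conj_im, hpair (v i) (fun l => hv l i) w' hw', neg_zero]
  refine ⟨Module.finrank ℝ W, finrank_range_le_card v, fun l => (b l : E), ?_, ?_, ?_⟩
  · rw [orthonormal_iff_ite]
    intro i j
    have h := orthonormal_iff_ite.1 b.orthonormal i j
    rw [Submodule.coe_inner, real_inner_eq_re_inner ℂ] at h
    apply Complex.ext
    · refine h.trans ?_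
      split_ifs <;> simp
    · rw [hWW _ (b i).2 _ (b j).2]
      split_ifs <;> simp
  · exact fun f hf l => hpair f hf _ (b l).2
  · intro i
    have hi : v i ∈ W := Submodule.subset_span ⟨i, rfl⟩
    have h := congrArg Subtype.val (b.sum_repr ⟨v i, hi⟩)
    rw [show v i = _ from h.symm, AddSubmonoidClass.coe_finsetSum]
    refine Submodule.sum_mem _ fun l _ => ?_
    change (b.repr ⟨v i, hi⟩ l) • (b l : E) ∈ _
    rw [← Complex.coe_smul]
    exact Submodule.smul_mem _ _ (Submodule.subset_span ⟨l, rfl⟩)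

theorem norm_sub_sum_inner_le {κ : Type*} [Fintype κ] {g : κ → E}
    (hg : Orthonormal ℂ g) (f w : E) (hw : w ∈ Submodule.span ℂ (Set.range g)) :
    ‖f - ∑ i, (inner ℂ (g i) f : ℂ) • g i‖ ≤ ‖f - w‖ := by
  classical
  set P := ∑ i, (inner ℂ (g i) f : ℂ) • g i with hP
  have hPmem : P ∈ Submodule.span ℂ (Set.range g) :=
    Submodule.sum_mem _ fun i _ => Submodule.smul_mem _ _ (Submodule.subset_span ⟨i, rfl⟩)
  have horth : ∀ s ∈ Submodule.span ℂ (Set.range g), (inner ℂ s (f - P) : ℂ) = 0 := by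
    intro s hs
    induction hs using Submodule.span_induction with
    | mem x hx =>
      obtain ⟨i, rfl⟩ := hx
      rw [inner_sub_right, hP, inner_sum]
      simp [inner_smul_right, orthonormal_iff_ite.1 hg]
    | zero => simp
    | add x y _ _ hx hy => rw [inner_add_left, hx, hy, add_zero]
    | smul r x _ hx => rw [inner_smul_left, hx, mul_zero]
  have h1 : f - w = (P - w) + (f - P) := by abel
  have h2 : ‖f - w‖ ^ 2 = ‖P - w‖ ^ 2 + ‖f - P‖ ^ 2 := by
    rw [h1, @norm_add_sq ℂ, horth _ (Submodule.sub_mem _ hPmem hw)]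
    simp
  exact le_of_sq_le_sq (by nlinarith [sq_nonneg ‖P - w‖]) (norm_nonneg _)

end RealForm

/-! ### Truncated plane waves -/

/-- The Taylor polynomial of the exponential of degree less than `n`. -/
def expTaylor (n : ℕ) (z : ℂ) : ℂ := ∑ m ∈ Finset.range n, z ^ m / m.factorial

/-- From `(8|z|)^n / n! ≤ e^{8|z|} ≤ e^n` one gets `|z|^n / n! ≤ (e/8)^n`: a number of terms
proportional to `ρ` already gives an exponentially small error. -/
theorem norm_exp_sub_expTaylor_le {n : ℕ} {ρ : ℝ} (hn : 8 * ρ ≤ n) {z : ℂ}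
    (hz : ‖z‖ ≤ ρ) : ‖Complex.exp z - expTaylor n z‖ ≤ 2 * (Real.exp 1 / 8) ^ n := by
  have hρ : 0 ≤ ρ := (norm_nonneg z).trans hz
  have h1 : ‖z‖ / n.succ ≤ 1 / 2 := by
    rw [div_le_iff₀ (by positivity)]
    push_cast
    linarith
  refine (Complex.exp_bound' h1).trans ?_
  have h2 : (8 * ‖z‖) ^ n / n.factorial ≤ Real.exp n := by
    refine (Real.pow_div_factorial_le_exp (8 * ‖z‖) (by positivity) n).trans ?_
    exact Real.exp_le_exp.2 (by linarith)
  rw [div_pow, ← Real.exp_nat_mul, mul_one]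
  have h3 : ‖z‖ ^ n / n.factorial = (8 * ‖z‖) ^ n / n.factorial / 8 ^ n := by
    rw [mul_pow]; field_simp
  rw [h3, mul_comm]
  exact mul_le_mul_of_nonneg_left (div_le_div_of_nonneg_right h2 (by positivity)) (by norm_num)

theorem norm_prod_exp_sub_le {n : ℕ} {ρ : ℝ} (hn : 8 * ρ ≤ n) (hn1 : 1 ≤ n) (z : Fin 3 → ℂ)
    (hz : ∀ i, ‖z i‖ ≤ ρ) (hre : ∀ i, (z i).re = 0) :
    ‖Complex.exp (∑ i, z i) - ∏ i, expTaylor n (z i)‖ ^ 2 ≤ 196 / 8 ^ n := by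
  set q := (Real.exp 1 / 8) ^ n with hq
  have he := Real.exp_one_lt_d9
  have hepos := Real.exp_pos 1
  have hq0 : 0 ≤ q := by positivity
  have hq1 : q ≤ 1 / 2 := by
    calc q ≤ (Real.exp 1 / 8) ^ 1 :=
          pow_le_pow_of_le_one (by positivity) (by rw [div_le_one (by norm_num)]; linarith) hn1
      _ ≤ 1 / 2 := by rw [pow_one, div_le_iff₀ (by norm_num)]; linarith
  have hd : ∀ i, ‖Complex.exp (z i) - expTaylor n (z i)‖ ≤ 2 * q := fun i =>
    norm_exp_sub_expTaylor_le hn (hz i)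
  have hexp : ∀ i, ‖Complex.exp (z i)‖ = 1 := fun i => by rw [Complex.norm_exp, hre, Real.exp_zero]
  have hT : ∀ i, ‖expTaylor n (z i)‖ ≤ 2 := by
    intro i
    have h := norm_sub_norm_le (expTaylor n (z i)) (Complex.exp (z i))
    rw [norm_sub_rev, hexp] at h
    linarith [hd i]
  -- Replace the factors one at a time: `14 = 2 + 4 + 8`, each Taylor polynomial being at most 2 in
  -- modulus. Squaring later uses `e² < 8`.
  have hmain : ‖Complex.exp (∑ i, z i) - ∏ i, expTaylor n (z i)‖ ≤ 14 * q := by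
    rw [Complex.exp_sum]
    simp only [Fin.prod_univ_three]
    have h : Complex.exp (z 0) * Complex.exp (z 1) * Complex.exp (z 2) -
        expTaylor n (z 0) * expTaylor n (z 1) * expTaylor n (z 2) =
        (Complex.exp (z 0) - expTaylor n (z 0)) * (Complex.exp (z 1) * Complex.exp (z 2)) +
        expTaylor n (z 0) * ((Complex.exp (z 1) - expTaylor n (z 1)) * Complex.exp (z 2)) +
        expTaylor n (z 0) * (expTaylor n (z 1) * (Complex.exp (z 2) - expTaylor n (z 2))) := by
      ring
    rw [h]
    refine (norm_add₃_le).trans ?_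
    simp only [norm_mul, hexp, mul_one]
    have h1 : ‖expTaylor n (z 0)‖ * ‖Complex.exp (z 1) - expTaylor n (z 1)‖ ≤ 2 * (2 * q) :=
      mul_le_mul (hT 0) (hd 1) (norm_nonneg _) (by norm_num)
    have h2 : ‖expTaylor n (z 1)‖ * ‖Complex.exp (z 2) - expTaylor n (z 2)‖ ≤ 2 * (2 * q) :=
      mul_le_mul (hT 1) (hd 2) (norm_nonneg _) (by norm_num)
    have h3 : ‖expTaylor n (z 0)‖ * (‖expTaylor n (z 1)‖ *
        ‖Complex.exp (z 2) - expTaylor n (z 2)‖) ≤ 2 * (2 * (2 * q)) :=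
      mul_le_mul (hT 0) h2 (by positivity) (by norm_num)
    linarith [hd 0]
  calc _ ≤ (14 * q) ^ 2 := pow_le_pow_left₀ (norm_nonneg _) hmain 2
    _ = 196 * ((Real.exp 1 / 8) ^ 2) ^ n := by rw [hq, mul_pow, ← pow_mul, mul_comm n 2, pow_mul]; norm_num
    _ ≤ 196 * (1 / 8) ^ n := by
        refine mul_le_mul_of_nonneg_left (pow_le_pow_left₀ (by positivity) ?_ n) (by norm_num)
        rw [div_pow]
        nlinarith
    _ = 196 / 8 ^ n := by rw [one_div, inv_pow]; rfl

/-! ### Reality of the field -/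

section Reality

variable {L Λ : ℝ} {hL : 0 < L}

/-- The rows `ε k 0`, `ε k 1`, `k/|k|` form an orthogonal matrix, so its columns are orthonormal as
well. The result is even in `k` and independent of the choice of polarizations, so no relation
between `ε k` and `ε (-k)` is required. -/
theorem IsPolarization.sum_mul {ε : Space → Fin 2 → Space} (hε : IsPolarization ε) {k : Space}
    (hk : k ≠ 0) (j l : Fin 3) :
    ∑ i, ε k i j * ε k i l = (if j = l then 1 else 0) - k j * k l / ‖k‖ ^ 2 := by
  have hk' : ‖k‖ ≠ 0 := norm_ne_zero_iff.2 hk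
  obtain ⟨h1, h2⟩ := hε k hk
  let O : Matrix (Fin 3) (Fin 3) ℝ := Matrix.of ![⇑(ε k 0), ⇑(ε k 1), fun i => k i / ‖k‖]
  have hkk : ∑ i, k i * k i = ‖k‖ ^ 2 := by
    rw [← Space.inner_eq, real_inner_self_eq_norm_sq]
  have e : ∀ i i', ∑ j, ε k i j * ε k i' j = if i = i' then 1 else 0 := fun i i' => by
    rw [← Space.inner_eq]; exact h1 i i'
  have e' : ∀ i, ∑ j, ε k i j * k j = 0 := fun i => by
    rw [← Space.inner_eq]; exact h2 i
  have hO : O * O.transpose = 1 := by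
    have e00 := e 0 0
    have e01 := e 0 1
    have e10 := e 1 0
    have e11 := e 1 1
    have e0 := e' 0
    have e1 := e' 1
    simp only [Fin.sum_univ_three] at e00 e01 e10 e11 e0 e1 hkk
    ext a b
    rw [Matrix.mul_apply, Fin.sum_univ_three]
    fin_cases a <;> fin_cases b <;>
      simp [O] at e00 e01 e10 e11 ⊢
    · exact e00
    · exact e01
    · field_simp; linarith
    · exact e10
    · exact e11
    · field_simp; linarith
    · field_simp; linarith
    · field_simp; linarith
    · field_simp; linarith
  have hO' := mul_eq_one_comm.1 hO
  have h3 := congrFun (congrFun hO' j) l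
  rw [Matrix.mul_apply, Fin.sum_univ_three] at h3
  simp only [O, Matrix.transpose_apply, Matrix.of_apply, Matrix.cons_val_zero, Matrix.cons_val_one,
    Matrix.cons_val, Matrix.one_apply] at h3
  rw [Fin.sum_univ_two, ← h3]
  field_simp
  ring

theorem waveVector_neg (L : ℝ) (n : Fin 3 → ℤ) : waveVector L (-n) = -waveVector L n := by
  ext i
  simp only [waveVector_apply, PiLp.neg_apply, Pi.neg_apply]
  push_cast
  ring

/-- The cutoff set is symmetric, and after summing over polarizations the terms at `k` and `-k` are
complex conjugates. -/
theorem im_sum_mode_eq_zero {ε : Space → Fin 2 → Space} (hε : IsPolarization ε) (F : Space → ℂ)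
    (hF : ∀ k, F (-k) = conj (F k)) (j l : Fin 3) :
    (∑ m : Mode L Λ hL, F m.k * ((ε m.k m.2 j * ε m.k m.2 l : ℝ) : ℂ)).im = 0 := by
  have h1 : ∑ m : Mode L Λ hL, F m.k * ((ε m.k m.2 j * ε m.k m.2 l : ℝ) : ℂ) =
      ∑ n ∈ cutoffLabels L Λ hL, F (waveVector L n) *
        ((∑ i, ε (waveVector L n) i j * ε (waveVector L n) i l : ℝ) : ℂ) := by
    rw [Fintype.sum_prod_type, ← Finset.sum_coe_sort (cutoffLabels L Λ hL)]
    refine Finset.sum_congr rfl fun n _ => ?_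
    rw [Complex.ofReal_sum, Finset.mul_sum]
    rfl
  rw [h1, ← Complex.conj_eq_iff_im, map_sum]
  refine Finset.sum_nbij' (fun n => -n) (fun n => -n) ?_ ?_ (fun n _ => neg_neg n)
    (fun n _ => neg_neg n) ?_
  · intro n hn
    rw [mem_cutoffLabels] at hn ⊢
    rw [waveVector_neg, norm_neg]
    exact ⟨neg_ne_zero.2 hn.1, hn.2⟩
  · intro n hn
    rw [mem_cutoffLabels] at hn ⊢
    rw [waveVector_neg, norm_neg]
    exact ⟨neg_ne_zero.2 hn.1, hn.2⟩
  · intro n hn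
    have hk := waveVector_ne_zero hL (mem_cutoffLabels.1 hn).1
    rw [waveVector_neg, hε.sum_mul hk, hε.sum_mul (neg_ne_zero.2 hk), hF, map_mul,
      Complex.conj_ofReal, norm_neg]
    simp only [PiLp.neg_apply, neg_mul_neg]

/-! ### One-particle vectors of the vector potential and their Taylor approximation -/

/-- The one-particle vector with momentum amplitude `u` and direction `j`. -/
def fieldVector (ε : Space → Fin 2 → Space) (j : Fin 3) (u : Space → ℂ) :
    EuclideanSpace ℂ (Mode L Λ hL) :=
  WithLp.toLp 2 fun m => u m.k * ((ε m.k m.2 j : ℝ) : ℂ)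

theorem im_inner_fieldVector {ε : Space → Fin 2 → Space} (hε : IsPolarization ε)
    {u w : Space → ℂ} (hu : ∀ k, u (-k) = conj (u k)) (hw : ∀ k, w (-k) = conj (w k))
    (j l : Fin 3) :
    (inner ℂ (fieldVector ε j u : EuclideanSpace ℂ (Mode L Λ hL)) (fieldVector ε l w) : ℂ).im =
      0 := by
  rw [PiLp.inner_apply, ← im_sum_mode_eq_zero (L := L) (Λ := Λ) (hL := hL) hε
    (fun k => conj (u k) * w k) (fun k => by simp [hu, hw]) j l]
  congr 1
  refine Finset.sum_congr rfl fun m _ => ?_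
  change (w m.k * ((ε m.k m.2 l : ℝ) : ℂ)) * conj (u m.k * ((ε m.k m.2 j : ℝ) : ℂ)) = _
  rw [map_mul, Complex.conj_ofReal]
  push_cast
  ring

/-- The coupling as a function of the wave vector. -/
def couplingAt (L : ℝ) (k : Space) : ℝ := 1 / Real.sqrt (2 * L ^ 3) * (1 / Real.sqrt ‖k‖)

theorem potentialVector_eq (ε : Space → Fin 2 → Space) (j : Fin 3) (x : Space) :
    (potentialVector ε j x : EuclideanSpace ℂ (Mode L Λ hL)) = fieldVector ε j fun k =>
      (couplingAt L k : ℂ) * Complex.exp (∑ i, -Complex.I * k i * x i) := by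
  ext m
  change ((m.coupling * ε m.k m.2 j : ℝ) : ℂ) * conj (planeWave m x) =
    (couplingAt L m.k : ℂ) * Complex.exp (∑ i, -Complex.I * m.k i * x i) * (ε m.k m.2 j : ℝ)
  have h : (-Complex.I * (inner ℝ m.k x : ℝ)) = ∑ i, -Complex.I * m.k i * x i := by
    rw [Space.inner_eq, Complex.ofReal_sum, Finset.mul_sum]
    exact Finset.sum_congr rfl fun i _ => by push_cast; ring
  rw [conj_planeWave, h, Complex.ofReal_mul]
  change (couplingAt L m.k : ℂ) * _ * _ = _
  ring

/-- The Taylor coefficients of the vector potential at the origin. -/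
def taylorVector (ε : Space → Fin 2 → Space) {n : ℕ} (β : (Fin 3 → Fin n) × Fin 3) :
    EuclideanSpace ℂ (Mode L Λ hL) :=
  fieldVector ε β.2 fun k => (couplingAt L k : ℂ) * ∏ i, (-Complex.I * k i) ^ (β.1 i : ℕ)

theorem couplingAt_neg (k : Space) : couplingAt L (-k) = couplingAt L k := by
  rw [couplingAt, norm_neg, couplingAt]

theorem conj_taylor_amplitude {n : ℕ} (β : Fin 3 → Fin n) (k : Space) :
    (couplingAt L (-k) : ℂ) * ∏ i, (-Complex.I * ((-k) i : ℝ)) ^ (β i : ℕ) =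
      conj ((couplingAt L k : ℂ) * ∏ i, (-Complex.I * (k i : ℝ)) ^ (β i : ℕ)) := by
  rw [couplingAt_neg, map_mul, Complex.conj_ofReal, map_prod]
  congr 1
  refine Finset.prod_congr rfl fun i _ => ?_
  simp

theorem im_inner_taylorVector {ε : Space → Fin 2 → Space} (hε : IsPolarization ε) {n : ℕ}
    (β γ : (Fin 3 → Fin n) × Fin 3) :
    (inner ℂ (taylorVector ε β : EuclideanSpace ℂ (Mode L Λ hL)) (taylorVector ε γ) : ℂ).im = 0 :=
  im_inner_fieldVector hε (conj_taylor_amplitude β.1) (conj_taylor_amplitude γ.1) _ _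

theorem im_inner_taylorVector_potentialVector {ε : Space → Fin 2 → Space} (hε : IsPolarization ε)
    {n : ℕ} (β : (Fin 3 → Fin n) × Fin 3) (j : Fin 3) (x : Space) :
    (inner ℂ (taylorVector ε β : EuclideanSpace ℂ (Mode L Λ hL)) (potentialVector ε j x) : ℂ).im =
      0 := by
  rw [potentialVector_eq]
  refine im_inner_fieldVector hε (conj_taylor_amplitude β.1) (fun k => ?_) _ _
  rw [couplingAt_neg, map_mul, Complex.conj_ofReal, ← Complex.exp_conj, map_sum]
  congr 2
  refine Finset.sum_congr rfl fun i _ => ?_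
  simp

/-- The Taylor approximation of the one-particle vector of the vector potential. -/
def potentialTaylor (ε : Space → Fin 2 → Space) (n : ℕ) (j : Fin 3) (x : Space) :
    EuclideanSpace ℂ (Mode L Λ hL) :=
  ∑ β : Fin 3 → Fin n, (∏ i, (x i : ℂ) ^ (β i : ℕ) / ((β i : ℕ).factorial : ℂ)) •
    taylorVector ε (β, j)

theorem potentialTaylor_apply (ε : Space → Fin 2 → Space) (n : ℕ) (j : Fin 3) (x : Space)
    (m : Mode L Λ hL) : (potentialTaylor ε n j x : EuclideanSpace ℂ (Mode L Λ hL)) m =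
      (couplingAt L m.k : ℂ) * (∏ i, expTaylor n (-Complex.I * m.k i * x i)) *
        (ε m.k m.2 j : ℝ) := by
  have h1 : ∏ i, expTaylor n (-Complex.I * m.k i * x i) = ∑ β : Fin 3 → Fin n,
      ∏ i, (-Complex.I * m.k i * x i) ^ (β i : ℕ) / ((β i : ℕ).factorial : ℂ) := by
    simp only [expTaylor, Finset.sum_range]
    rw [Finset.prod_univ_sum, Fintype.piFinset_univ]
  rw [h1, potentialTaylor, WithLp.ofLp_sum, Finset.sum_apply, Finset.mul_sum, Finset.sum_mul]
  refine Finset.sum_congr rfl fun β _ => ?_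
  change (∏ i, (x i : ℂ) ^ (β i : ℕ) / ((β i : ℕ).factorial : ℂ)) *
    ((couplingAt L m.k : ℂ) * (∏ i, (-Complex.I * m.k i) ^ (β i : ℕ)) * (ε m.k m.2 j : ℝ)) = _
  have h2 : ∏ i, (-Complex.I * m.k i * x i) ^ (β i : ℕ) / ((β i : ℕ).factorial : ℂ) =
      (∏ i, (x i : ℂ) ^ (β i : ℕ) / ((β i : ℕ).factorial : ℂ)) *
        ∏ i, (-Complex.I * m.k i) ^ (β i : ℕ) := by
    rw [← Finset.prod_mul_distrib]
    refine Finset.prod_congr rfl fun i _ => ?_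
    rw [mul_pow (-Complex.I * (m.k i : ℂ))]
    ring
  rw [h2]
  ring

theorem sum_norm_fieldVector_sq_le {ε : Space → Fin 2 → Space} (hε : IsPolarization ε)
    (hΛ : 0 < Λ) {B : ℝ} (hB : 0 ≤ B) (f : Fin 3 → EuclideanSpace ℂ (Mode L Λ hL))
    (hf : ∀ j m, ‖f j m‖ ^ 2 ≤ B * (m.coupling ^ 2 * ε m.k m.2 j ^ 2)) :
    ∑ j, ‖f j‖ ^ 2 ≤ B * Λ ^ 2 := by
  simp only [EuclideanSpace.norm_sq_eq]
  refine (Finset.sum_le_sum fun j _ => Finset.sum_le_sum fun m _ => hf j m).trans ?_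
  simp only [← Finset.mul_sum]
  refine mul_le_mul_of_nonneg_left ?_ hB
  rw [Finset.sum_comm]
  simp only [← Finset.mul_sum, hε.sum_sq, mul_one]
  exact sum_coupling_sq_le hΛ

/-- Squeeze an orthonormal basis of the real span of the `3n³` Taylor vectors. One `Θ` then serves
all `x` in the region: the Taylor vectors do not depend on `x`. The two errors are the residual
fluctuation `6/N` in the span and the Taylor remainder outside it. -/
theorem exists_trial_vector {ε : Space → Fin 2 → Space} (hε : IsPolarization ε) (hΛ : 0 < Λ)
    {n N : ℕ} (hn1 : 1 ≤ n) (hN : 0 < N) {ρ : ℝ} (hρ : 8 * ρ ≤ n) :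
    ∃ Θ : FockSpace (Mode L Λ hL), Θ ≠ 0 ∧ Θ ∈ atMost (2 * N * (3 * n ^ 3)) ∧
      ∀ x : Space, (∀ (m : Mode L Λ hL) i, |m.k i * x i| ≤ ρ) →
        ∑ j, ‖ann fockAnn (potentialVector ε j x) Θ + cre fockCre (potentialVector ε j x) Θ‖ ^ 2 ≤
          (6 / N + 196 / 8 ^ n) * Λ ^ 2 * ‖Θ‖ ^ 2 := by
  obtain ⟨M, hM, g, hg, hgreal, hgspan⟩ := exists_orthonormal_of_real
    (fun β : (Fin 3 → Fin n) × Fin 3 =>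
      (taylorVector ε β : EuclideanSpace ℂ (Mode L Λ hL))) (im_inner_taylorVector hε)
  have hM' : M ≤ 3 * n ^ 3 := by
    refine hM.trans (le_of_eq ?_)
    simp [mul_comm]
  obtain ⟨Θ, hΘ0, hΘd, -, hΘX⟩ := exists_squeezed (fock_isCCR (ι := Mode L Λ hL)) atMost
    atMost_mono cre_mem_atMost vacuum vacuum_ne_zero (fun m hm => by
      by_contra h
      have hm0 : m ≠ 0 := by
        rintro rfl
        simp at h
      exact hm (Set.indicator_of_notMem (s := {(0 : Mode L Λ hL → ℕ)}) hm0
        (1 : (Mode L Λ hL → ℕ) → ℂ)))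
    fockAnn_vacuum g hg hN Finset.univ
  rw [Finset.card_univ, Fintype.card_fin] at hΘd
  refine ⟨Θ, hΘ0, atMost_mono (Nat.mul_le_mul_left _ hM') hΘd, fun x hx => ?_⟩
  have h1 : ∀ j, ‖ann fockAnn (potentialVector ε j x) Θ +
      cre fockCre (potentialVector ε j x) Θ‖ ^ 2 ≤
      (6 / N * ‖(potentialVector ε j x : EuclideanSpace ℂ (Mode L Λ hL))‖ ^ 2 +
        ‖(potentialVector ε j x : EuclideanSpace ℂ (Mode L Λ hL)) - potentialTaylor ε n j x‖ ^ 2) *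
        ‖Θ‖ ^ 2 := by
    intro j
    have hreal := hgreal (potentialVector ε j x) fun β =>
      im_inner_taylorVector_potentialVector hε β j x
    refine (hΘX _ fun i _ => hreal i).trans (mul_le_mul_of_nonneg_right ?_ (by positivity))
    refine add_le_add (mul_le_mul_of_nonneg_left ?_ (by positivity)) ?_
    · exact hg.sum_inner_products_le _
    · refine pow_le_pow_left₀ (norm_nonneg _) (norm_sub_sum_inner_le hg _ _ ?_) 2
      exact Submodule.sum_mem _ fun β _ => Submodule.smul_mem _ _ (hgspan (β, j))
  refine (Finset.sum_le_sum fun j _ => h1 j).trans ?_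
  rw [← Finset.sum_mul, Finset.sum_add_distrib, ← Finset.mul_sum]
  refine mul_le_mul_of_nonneg_right ?_ (sq_nonneg _)
  rw [add_mul]
  refine add_le_add ?_ ?_
  · refine mul_le_mul_of_nonneg_left ?_ (by positivity)
    rw [← one_mul (Λ ^ 2)]
    refine sum_norm_fieldVector_sq_le hε hΛ zero_le_one _ fun j m => ?_
    have h2 : ‖planeWave m x‖ = 1 := by
      rw [planeWave, mul_comm, Complex.norm_exp_ofReal_mul_I]
    change ‖((m.coupling * ε m.k m.2 j : ℝ) : ℂ) * conj (planeWave m x)‖ ^ 2 ≤ _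
    rw [norm_mul, RCLike.norm_conj, h2, mul_one, one_mul, Complex.norm_real, Real.norm_eq_abs,
      sq_abs, mul_pow]
  · refine sum_norm_fieldVector_sq_le hε hΛ (by positivity) _ fun j m => ?_
    rw [PiLp.sub_apply, potentialTaylor_apply, potentialVector_eq]
    change ‖(couplingAt L m.k : ℂ) * Complex.exp (∑ i, -Complex.I * m.k i * x i) *
      (ε m.k m.2 j : ℝ) - (couplingAt L m.k : ℂ) *
      (∏ i, expTaylor n (-Complex.I * m.k i * x i)) * (ε m.k m.2 j : ℝ)‖ ^ 2 ≤ _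
    rw [← sub_mul, ← mul_sub, norm_mul, norm_mul, Complex.norm_real, Complex.norm_real, mul_pow,
      mul_pow, Real.norm_eq_abs, Real.norm_eq_abs, sq_abs, sq_abs]
    have h3 := norm_prod_exp_sub_le hρ hn1 (fun i => -Complex.I * m.k i * x i)
      (fun i => by
        rw [norm_mul, norm_mul, norm_neg, Complex.norm_I, one_mul, Complex.norm_real,
          Complex.norm_real, ← norm_mul]
        exact hx m i) (fun i => by simp)
    have h4 : (0 : ℝ) ≤ m.coupling ^ 2 * ε m.k m.2 j ^ 2 := by positivity
    have h5 := mul_le_mul_of_nonneg_right h3 h4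
    refine le_trans (le_of_eq ?_) h5
    change m.coupling ^ 2 * _ * _ = _
    ring

end Reality

/-! ### The bounds on the ground state energy -/

section GroundState

variable {L Λ : ℝ} {hL : 0 < L}

theorem energy_nonneg (α : ℝ) (ε : Space → Fin 2 → Space) (Ψ : CoreSpace L Λ hL) :
    0 ≤ energy α ε Ψ := by
  unfold energy
  positivity

theorem groundStateEnergy_le (α : ℝ) (ε : Space → Fin 2 → Space) (Ψ : CoreSpace L Λ hL)
    (hΨ : Ψ ≠ 0) : groundStateEnergy α Λ L hL ε ≤ energy α ε Ψ / ‖Ψ‖ ^ 2 := by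
  refine csInf_le ⟨0, ?_⟩ ⟨Ψ.1, Ψ.isCore, fun h => hΨ (Subtype.ext h), ?_⟩
  · rintro e ⟨Φ, hΦ, -, rfl⟩
    have h1 := innerProduct_hamiltonian α ε (⟨Φ, hΦ⟩ : CoreSpace L Λ hL)
    have h2 := innerProduct_self_re (⟨Φ, hΦ⟩ : CoreSpace L Λ hL)
    rw [h1, h2]
    exact div_nonneg (energy_nonneg _ _ _) (by positivity)
  · rw [innerProduct_hamiltonian, innerProduct_self_re]

/-- The vector `Ψ` only shows that the set of quotients is nonempty; `sInf` of the empty set would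
be the default value 0. -/
theorem le_groundStateEnergy (α : ℝ) (ε : Space → Fin 2 → Space) (Ψ : CoreSpace L Λ hL)
    (hΨ : Ψ ≠ 0) {c : ℝ} (hc : ∀ Φ : CoreSpace L Λ hL, c * ‖Φ‖ ^ 2 ≤ energy α ε Φ) :
    c ≤ groundStateEnergy α Λ L hL ε := by
  refine le_csInf ⟨_, Ψ.1, Ψ.isCore, fun h => hΨ (Subtype.ext h), rfl⟩ ?_
  rintro e ⟨Φ, hΦ, hΦ0, rfl⟩
  have h1 := innerProduct_hamiltonian α ε (⟨Φ, hΦ⟩ : CoreSpace L Λ hL)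
  have h2 := innerProduct_self_re (⟨Φ, hΦ⟩ : CoreSpace L Λ hL)
  have h0 : (⟨Φ, hΦ⟩ : CoreSpace L Λ hL) ≠ 0 := fun h => hΦ0 (congrArg Subtype.val h)
  rw [h1, h2]
  exact (le_div_iff₀ (pow_pos (norm_pos_iff.2 h0) 2)).2 (hc _)

/-- Dilating one fixed bump function scales the gradient term by `K²`, so `κ` is universal. -/
theorem exists_electron : ∃ κ : ℝ, 0 ≤ κ ∧ ∀ K : ℝ, 0 < K → ∃ φ : Space → ℝ,
    ContDiff ℝ ∞ φ ∧ HasCompactSupport φ ∧ (0 < ∫ x, φ x ^ 2) ∧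
    (∑ j, (∫ x, (fderiv ℝ φ x (EuclideanSpace.single j 1)) ^ 2) = K ^ 2 * κ * ∫ x, φ x ^ 2) ∧
    ∀ x, φ x ≠ 0 → ‖x‖ ≤ 1 / K := by
  let η : ContDiffBump (0 : Space) := ⟨1 / 2, 1, by norm_num, by norm_num⟩
  have hη : ContDiff ℝ ∞ η := η.contDiff
  have hηc : HasCompactSupport η := η.hasCompactSupport
  have hpos : 0 < ∫ x, η x ^ 2 := by
    have hcont : Continuous fun x => η x ^ 2 := hη.continuous.pow 2
    refine hcont.integral_pos_of_hasCompactSupport_nonneg_nonzero (x := 0) ?_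
      (fun x => sq_nonneg _) ?_
    · simp only [sq]
      exact hηc.mul_left
    · have : η 0 = 1 := η.one_of_mem_closedBall (Metric.mem_closedBall_self η.rIn_pos.le)
      simp [this]
  refine ⟨(∑ j, (∫ x, (fderiv ℝ η x (EuclideanSpace.single j 1)) ^ 2)) / ∫ x, η x ^ 2,
    div_nonneg (Finset.sum_nonneg fun j _ => integral_nonneg fun x => sq_nonneg _) hpos.le,
    fun K hK => ⟨fun x => η (K • x), ?_, ?_, ?_, ?_, ?_⟩⟩
  · exact hη.comp (contDiff_const_smul K)
  · exact hηc.comp_smul hK.ne'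
  · rw [Measure.integral_comp_smul volume (fun x => η x ^ 2)]
    have : 0 < |(K ^ Module.finrank ℝ Space)⁻¹| := by positivity
    rw [smul_eq_mul]
    positivity
  · have hder : ∀ x (j : Fin 3), fderiv ℝ (fun x => η (K • x)) x (EuclideanSpace.single j 1) =
        K * fderiv ℝ η (K • x) (EuclideanSpace.single j 1) := by
      intro x j
      have h1 : HasFDerivAt η (fderiv ℝ η (K • x)) (K • x) :=
        ((hη.differentiable (by simp)) _).hasFDerivAt
      have h2 : HasFDerivAt (fun x : Space => K • x)
          (K • ContinuousLinearMap.id ℝ Space) x := (hasFDerivAt_id x).const_smul K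
      have h3 : HasFDerivAt (fun x => η (K • x)) _ x := h1.comp x h2
      rw [h3.fderiv]
      simp
    simp only [hder, mul_pow, integral_const_mul]
    have h4 : ∀ j : Fin 3,
        ∫ x : Space, fderiv ℝ η (K • x) (EuclideanSpace.single j 1) ^ 2 =
        |(K ^ Module.finrank ℝ Space)⁻¹| *
          ∫ x, fderiv ℝ η x (EuclideanSpace.single j 1) ^ 2 := fun j =>
      Measure.integral_comp_smul volume
        (fun x => fderiv ℝ η x (EuclideanSpace.single j 1) ^ 2) K
    rw [Measure.integral_comp_smul volume (fun x => η x ^ 2), smul_eq_mul]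
    simp only [h4, ← Finset.mul_sum]
    field_simp
  · intro x hx
    have h1 : K • x ∈ Metric.ball (0 : Space) 1 := by
      have : K • x ∈ Function.support η := hx
      rwa [η.support_eq] at this
    rw [mem_ball_zero_iff, norm_smul, Real.norm_eq_abs, abs_of_pos hK] at h1
    rw [le_div_iff₀ hK, mul_comm]
    exact h1.le

/-- With `Λ = α r⁷` the exponents become integers. The trial state also supplies the nonzero core
vector that the lower bound needs. -/
theorem groundStateEnergy_le_of_scale {κ : ℝ} (hκ : ∀ K : ℝ, 0 < K → ∃ φ : Space → ℝ,
      ContDiff ℝ ∞ φ ∧ HasCompactSupport φ ∧ (0 < ∫ x, φ x ^ 2) ∧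
      (∑ j, (∫ x, (fderiv ℝ φ x (EuclideanSpace.single j 1)) ^ 2) = K ^ 2 * κ * ∫ x, φ x ^ 2) ∧
      ∀ x, φ x ≠ 0 → ‖x‖ ≤ 1 / K)
    {ε : Space → Fin 2 → Space} (hε : IsPolarization ε) {α r : ℝ} (hα : 0 < α) (hr : 1 ≤ r)
    (hαr : 1 ≤ α * r) (hrα : α ≤ r) (hΛ : Λ = α * r ^ 7) :
    (∃ Ψ : CoreSpace L Λ hL, Ψ ≠ 0) ∧
      groundStateEnergy α Λ L hL ε ≤ (κ + 9000) * (α ^ 2 * r ^ 12) := by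
  have hr0 : 0 < r := by linarith
  have hΛ0 : 0 < Λ := by rw [hΛ]; positivity
  have hκ0 : 0 ≤ κ := by
    obtain ⟨φ, -, -, hpos, hgrad, -⟩ := hκ 1 one_pos
    have h : 0 ≤ ∑ j, (∫ x, (fderiv ℝ φ x (EuclideanSpace.single j 1)) ^ 2) :=
      Finset.sum_nonneg fun j _ => integral_nonneg fun x => sq_nonneg _
    rw [hgrad, one_pow, one_mul] at h
    exact nonneg_of_mul_nonneg_left h hpos
  obtain ⟨φ, hφ, hc, hpos, hgrad, hsupp⟩ := hκ (α * r ^ 6) (by positivity)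
  -- `Λ/K = r` bounds the phases, hence `n ≥ 8r`; `N ~ α r²` balances `αΛ²/N` against the photon
  -- energy `Λ N n³`.
  set n : ℕ := ⌈8 * r⌉₊ with hn
  set N : ℕ := ⌈α * r ^ 2⌉₊ with hNdef
  have hαr2 : 1 ≤ α * r ^ 2 := by nlinarith
  have hn1 : 8 * r ≤ n := Nat.le_ceil _
  have hn2 : (n : ℝ) ≤ 9 * r := by
    have := Nat.ceil_lt_add_one (show 0 ≤ 8 * r by positivity)
    linarith
  have hN1 : α * r ^ 2 ≤ N := Nat.le_ceil _
  have hN2 : (N : ℝ) ≤ 2 * (α * r ^ 2) := by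
    have := Nat.ceil_lt_add_one (show 0 ≤ α * r ^ 2 by positivity)
    linarith
  have hnpos : 1 ≤ n := Nat.one_le_ceil_iff.2 (by positivity)
  have hNpos : 0 < N := Nat.ceil_pos.2 (by positivity)
  have hN0 : (0 : ℝ) < N := by exact_mod_cast hNpos
  obtain ⟨Θ, hΘ0, hΘd, hΘ⟩ := exists_trial_vector (L := L) (hL := hL) hε hΛ0 hnpos hNpos hn1
  have hnorm := norm_tensor_sq φ hφ hc Θ
  have hnormpos : 0 < ‖tensor φ hφ hc Θ‖ ^ 2 := by
    rw [hnorm]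
    exact mul_pos hpos (pow_pos (norm_pos_iff.2 hΘ0) 2)
  have hne : tensor φ hφ hc Θ ≠ 0 := by
    intro h
    rw [h, norm_zero] at hnormpos
    norm_num at hnormpos
  refine ⟨⟨_, hne⟩, (groundStateEnergy_le α ε _ hne).trans ?_⟩
  rw [div_le_iff₀ hnormpos]
  refine (energy_tensor_le hΛ0.le hα φ hφ hc Θ ε (fun x hx => hΘ x fun m i => ?_) hΘd).trans ?_
  · have h1 : |m.k i| ≤ Λ := (PiLp.norm_apply_le m.k i).trans m.norm_k_lt.le
    have h2 : |x i| ≤ 1 / (α * r ^ 6) := (PiLp.norm_apply_le x i).trans (hsupp x hx)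
    rw [abs_mul]
    refine (mul_le_mul h1 h2 (abs_nonneg _) hΛ0.le).trans (le_of_eq ?_)
    rw [hΛ]
    field_simp
  rw [hgrad, hnorm, ← mul_assoc ((κ + 9000) * (α ^ 2 * r ^ 12)), ← mul_assoc (1 / 2 : ℝ),
    ← mul_assoc (1 / 2 : ℝ), ← add_mul]
  refine mul_le_mul_of_nonneg_right (mul_le_mul_of_nonneg_right ?_ hpos.le) (sq_nonneg _)
  have t1 : α / 2 * (6 / N * Λ ^ 2) ≤ 3 * (α ^ 2 * r ^ 12) := by
    have h1 : (6 : ℝ) / N ≤ 6 / (α * r ^ 2) :=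
      div_le_div_of_nonneg_left (by norm_num) (by positivity) hN1
    calc α / 2 * (6 / N * Λ ^ 2) ≤ α / 2 * (6 / (α * r ^ 2) * Λ ^ 2) := by gcongr
      _ = 3 * (α ^ 2 * r ^ 12) := by rw [hΛ]; field_simp; ring
  -- Of the exponential smallness only `8^n ≥ (8r)³` is used; the spare power of `α` is traded for
  -- `r` through `α ≤ r`.
  have t2 : α / 2 * (196 / 8 ^ n * Λ ^ 2) ≤ α ^ 2 * r ^ 12 := by
    have h1 : (8 * r) ^ 3 ≤ (8 : ℝ) ^ n := by
      have h2 : (n : ℝ) ≤ 2 ^ n := by exact_mod_cast Nat.lt_two_pow_self.le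
      calc (8 * r) ^ 3 ≤ ((2 : ℝ) ^ n) ^ 3 := pow_le_pow_left₀ (by positivity) (hn1.trans h2) 3
        _ = 8 ^ n := by rw [← pow_mul, mul_comm, pow_mul]; norm_num
    have h2 : (196 : ℝ) / 8 ^ n ≤ 196 / (8 * r) ^ 3 :=
      div_le_div_of_nonneg_left (by norm_num) (by positivity) h1
    calc α / 2 * (196 / 8 ^ n * Λ ^ 2) ≤ α / 2 * (196 / (8 * r) ^ 3 * Λ ^ 2) := by gcongr
      _ = 49 / 256 * (α ^ 2 * r ^ 11) * α := by rw [hΛ]; field_simp; ring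
      _ ≤ 49 / 256 * (α ^ 2 * r ^ 11) * r := by gcongr
      _ ≤ α ^ 2 * r ^ 12 := by
        have : 0 < α ^ 2 * r ^ 12 := by positivity
        nlinarith
  have t3 : Λ * ((2 * N * (3 * n ^ 3) : ℕ) : ℝ) ≤ 8748 * (α ^ 2 * r ^ 12) := by
    push_cast
    calc Λ * (2 * N * (3 * (n : ℝ) ^ 3)) ≤ Λ * (2 * (2 * (α * r ^ 2)) * (3 * (9 * r) ^ 3)) := by
          gcongr
      _ = 8748 * (α ^ 2 * r ^ 12) := by rw [hΛ]; ring
  have t4 : 1 / 2 * (α * r ^ 6) ^ 2 * κ ≤ κ * (α ^ 2 * r ^ 12) := by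
    have h1 : (α * r ^ 6) ^ 2 = α ^ 2 * r ^ 12 := by ring
    rw [h1]
    have : 0 ≤ α ^ 2 * r ^ 12 * κ := by positivity
    linarith
  have t0 : 0 < α ^ 2 * r ^ 12 := by positivity
  have e1 : α / 2 * ((6 / N + 196 / 8 ^ n) * Λ ^ 2) =
      α / 2 * (6 / N * Λ ^ 2) + α / 2 * (196 / 8 ^ n * Λ ^ 2) := by ring
  rw [e1]
  linarith

theorem lower_estimate {α : ℝ} (hα : 0 < α) (hΛ : 0 < Λ) (h1 : 8 * Real.pi ≤ L * Λ)
    (h2 : 4900 ≤ α * Λ) {ε : Space → Fin 2 → Space} (hε : IsPolarization ε)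
    (hne : ∃ Ψ : CoreSpace L Λ hL, Ψ ≠ 0) :
    1 / 200 * α ^ (1 / 2 : ℝ) * Λ ^ (3 / 2 : ℝ) < groundStateEnergy α Λ L hL ε := by
  obtain ⟨Ψ, hΨ⟩ := hne
  have hcard : (L * Λ) ^ 3 / 1600 ≤ (Fintype.card (Mode L Λ hL) : ℝ) := card_mode_ge h1
  have hM : 0 < Fintype.card (Mode L Λ hL) := by
    have : (0 : ℝ) < (Fintype.card (Mode L Λ hL) : ℝ) := lt_of_lt_of_le (by positivity) hcard
    exact_mod_cast this
  refine lt_of_lt_of_le ?_ (le_groundStateEnergy α ε Ψ hΨ (energy_lower_bound α hε hM))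
  have h3 : Λ ^ (3 / 2 : ℝ) = Λ * Real.sqrt Λ := by
    rw [show (3 / 2 : ℝ) = 1 + 1 / 2 by norm_num, Real.rpow_add hΛ, Real.rpow_one,
      ← Real.sqrt_eq_rpow]
  have h4 : Λ * Real.sqrt Λ / 40 ≤ Real.sqrt (Fintype.card (Mode L Λ hL) / L ^ 3) := by
    apply Real.le_sqrt_of_sq_le
    rw [div_pow, mul_pow, Real.sq_sqrt hΛ.le, le_div_iff₀ (by positivity)]
    refine le_trans (le_of_eq ?_) hcard
    ring
  have h5 : 70 ≤ Real.sqrt α * Real.sqrt Λ := by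
    rw [← Real.sqrt_mul hα.le]
    exact Real.le_sqrt_of_sq_le (by linarith)
  rw [h3, ← Real.sqrt_eq_rpow]
  have h6 := mul_le_mul_of_nonneg_left h4 (Real.sqrt_nonneg α)
  have h7 := mul_le_mul_of_nonneg_right h5 hΛ.le
  -- The main term is at least `√α Λ^{3/2}/80`, and `√(αΛ) ≥ 70` makes `Λ/2` at most `√α
  -- Λ^{3/2}/140`; the difference exceeds `1/200` of `√α Λ^{3/2}`.
  nlinarith

theorem upper_scale {α r : ℝ} (hα : 0 < α) (hr : 0 < r) (hΛ : Λ = α * r ^ 7) :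
    α ^ (2 / 7 : ℝ) * Λ ^ (12 / 7 : ℝ) = α ^ 2 * r ^ 12 := by
  have h1 : (r ^ 7 : ℝ) ^ (12 / 7 : ℝ) = r ^ 12 := by
    rw [← Real.rpow_natCast, ← Real.rpow_natCast, ← Real.rpow_mul hr.le]
    norm_num
  rw [hΛ, Real.mul_rpow hα.le (by positivity), h1, ← mul_assoc, ← Real.rpow_add hα]
  norm_num

end GroundState

end NonRelQED

end

theorem theorem1 :
    ∃ C₁ C₂ : ℝ, 0 < C₁ ∧ 0 < C₂ ∧
      ∀ α : ℝ, 0 < α → ∀ L₀ : ℝ, 0 < L₀ →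
        ∃ Λ₀ : ℝ, 0 < Λ₀ ∧
          ∀ Λ : ℝ, Λ₀ ≤ Λ → ∀ (L : ℝ) (hL : 0 < L), L₀ ≤ L →
            ∀ ε : NonRelQED.Space → Fin 2 → NonRelQED.Space, NonRelQED.IsPolarization ε →
              C₁ * α ^ (1 / 2 : ℝ) * Λ ^ (3 / 2 : ℝ) <
                  NonRelQED.groundStateEnergy α Λ L hL ε ∧
                NonRelQED.groundStateEnergy α Λ L hL ε <
                  C₂ * α ^ (2 / 7 : ℝ) * Λ ^ (12 / 7 : ℝ) := by
  obtain ⟨κ, hκ0, hκ⟩ := NonRelQED.exists_electron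
  refine ⟨1 / 200, κ + 9001, by norm_num, by positivity, fun α hα L₀ hL₀ => ?_⟩
  have hpi := Real.pi_pos
  -- The first summand forces `r = (Λ/α)^{1/7}` above `1`, `α` and `1/α`; the second gives `LΛ ≥ 8π`
  -- for all `L ≥ L₀`; the third gives `αΛ ≥ 70²`.
  refine ⟨α * (1 + α + 1 / α) ^ 7 + 8 * Real.pi / L₀ + 4900 / α, by positivity,
    fun Λ hΛ₀ L hL hLL ε hε => ?_⟩
  have p1 : 0 < α * (1 + α + 1 / α) ^ 7 := by positivity
  have p2 : 0 < 8 * Real.pi / L₀ := by positivity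
  have p3 : 0 < 4900 / α := by positivity
  have hΛ : 0 < Λ := by linarith
  set r : ℝ := (Λ / α) ^ (1 / 7 : ℝ) with hrdef
  have hr7 : r ^ 7 = Λ / α := by
    rw [hrdef, ← Real.rpow_natCast, ← Real.rpow_mul (by positivity)]
    norm_num
  have hr0 : 0 < r := by positivity
  have hΛr : Λ = α * r ^ 7 := by rw [hr7]; field_simp
  have hrge : 1 + α + 1 / α ≤ r := by
    refine le_of_pow_le_pow_left₀ (n := 7) (by norm_num) hr0.le ?_
    rw [hr7, le_div_iff₀ hα]
    linarith
  have hα' : 0 < 1 / α := by positivity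
  have hαr : 1 ≤ α * r := by
    have h1 := mul_le_mul_of_nonneg_left (show 1 / α ≤ r by linarith) hα.le
    rwa [mul_one_div_cancel hα.ne'] at h1
  obtain ⟨hne, hup⟩ := NonRelQED.groundStateEnergy_le_of_scale (L := L) (hL := hL) hκ hε hα
    (by linarith) hαr (by linarith) hΛr
  refine ⟨NonRelQED.lower_estimate hα hΛ ?_ ?_ hε hne, ?_⟩
  · have h1 : 8 * Real.pi / L₀ ≤ Λ := by linarith
    rw [div_le_iff₀ hL₀] at h1
    nlinarith
  · have h1 : 4900 / α ≤ Λ := by linarith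
    rw [div_le_iff₀ hα] at h1
    linarith
  · rw [mul_assoc, NonRelQED.upper_scale hα hr0 hΛr]
    have : 0 < α ^ 2 * r ^ 12 := by positivity
    nlinarith
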